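/- **Setting.** Let $L=\bigcup_{n\in\mathbb N}L_n$ be an alphabet, where the $L_n$ are finite and $L_n\subseteq L_{n+1}$ for all $n$, and let $v\notin L$ be a variable. $W_L$ is the set of words over $L$, and $W_{Lv}$ is the set of words over $L\cup\{v\}$ in which $v$ occurs. A sequence of words $(x_n)_{n\in\mathbb N}$ is *rapidly increasing* if $|x_n|>\sum_{i<n}|x_i|$ for all $n$. Let $W_L^{[\infty]}$ and $W_{Lv}^{[\infty]}$ be the sets of rapidly increasing infinite sequences in $W_L$ and in $W_{Lv}$, respectively. For $x\in W_{Lv}$, let $x[\lambda]$ be the result of replacing $v$ by $\lambda$ in $x$. For $X=(x_n)_n\in W_{Lv}^{[\infty]}$, let $[X]_L$ be the set of all words $w=x_{n_0}[\lambda_0]^\smallfrown\cdots^\smallfrown x_{n_k}[\lambda_k]$ with $k\ge 0$, $n_0<\cdots<n_k$ and $\lambda_i\in L_{n_i}$, and let $[X]_{Lv}$ be the set of all such $w\in W_{Lv}$ with $\lambda_i\in L_{n_i}\cup\{v\}$. The set $\{n_0,\dots,n_k\}$ is uniquely determined by $w$ and $X$; it is denoted by $\mathrm{supp}_X(w)$.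 For $Y=(y_n)_n\in W_{Lv}^{[\infty]}$ write $Y\le X$ if $y_n\in[X]_{Lv}$ for all $n$ and $\max\mathrm{supp}_X(y_n)<\min\mathrm{supp}_X(y_m)$ for all $n<m$. For $A=(w_n)_n\in W_L^{[\infty]}$ write $A\le^0X$ if $w_n\in[X]_L$ for all $n$ and $\max\mathrm{supp}_X(w_n)<\min\mathrm{supp}_X(w_m)$ for all $n<m$. For a finite sequence $a$ of words over $L$ and $Y\in W_{Lv}^{[\infty]}$, let $$[a,Y]=\{A\in W_L^{[\infty]}: A\le^0Y\text{ and } a\text{ is an initial segment of }A\}.$$ If $[a,Y]\ne\emptyset$, let $\mathrm{depth}_Y(a)$ be the least $k$ such that every word of $a$ lies in $[Y]_L$ with support in $Y$ contained in $\{0,\dots,k-1\}$, the supports of the successive words of $a$ being in increasing block position as above. For $n\in\mathbb N$, let $[n,Y]$ be the set of all $X\in W_{Lv}^{[\infty]}$ with $X\le Y$ whose first $n$ terms are those of $Y$. Let $\mathbb P$ be the family of nonempty perfect subsets of the Cantor space $2^\infty$, and let $\Lambda\subseteq 2^\infty\times W_L^{[\infty]}$. * $\Lambda$ is *perfectly Ramsey*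 if for every $Q\in\mathbb P$ and every $[a,Y]\neq\emptyset$ there are $M\in\mathbb P$ with $M\subseteq Q$ and $X\in[\mathrm{depth}_Y(a),Y]$ with $[a,X]\ne\emptyset$ such that $M\times[a,X]\subseteq\Lambda$ or $M\times[a,X]\subseteq\Lambda^c$. It is *perfectly Ramsey null* if in this situation $M$ and $X$ can always be found with $M\times[a,X]\subseteq\Lambda^c$. * $\Lambda$ has the *$\mathbb P\times W_{Lv}^{[\infty]}$-Baire property* if for every $Q\in\mathbb P$ and every $[a,Y]\neq\emptyset$ there are $M\in\mathbb P$ with $M\subseteq Q$ and a nonempty $[b,X]\subseteq[a,Y]$ such that $M\times[b,X]\subseteq\Lambda$ or $M\times[b,X]\subseteq\Lambda^c$. It is *$\mathbb P\times W_{Lv}^{[\infty]}$-meager* if in this situation $M$ and $[b,X]$ can always be found with $M\times[b,X]\subseteq\Lambda^c$. **Theorem (Parametrized infinite dimensional Hales–Jewett theorem).** For every $\Lambda\subseteq 2^\infty\times W_L^{[\infty]}$: 1. $\Lambda$ is perfectly Ramsey if and only if it has the $\mathbb P\times W_{Lv}^{[\infty]}$-Baire property. 2. $\Lambda$ is perfectly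 Ramsey null if and only if it is $\mathbb P\times W_{Lv}^{[\infty]}$-meager. -/

import Mathlib

namespace HalesJewettSpace

/-- A sequence of words is rapidly increasing if each word is strictly longer than all the
previous ones put together (in particular every word is nonempty). -/
def RapidlyIncreasing {β : Type*} (x : ℕ → List β) : Prop :=
  ∀ n, ∑ i ∈ Finset.range n, (x i).length < (x n).length

/-- Rapidly increasing infinite sequences of words over the alphabet `α`. -/
def WordSeq (α : Type*) : Type _ :=
  {A : ℕ → List α // RapidlyIncreasing A}

/-- Rapidly increasing infinite sequences of variable words over `α`. The letters of a variable
word are taken in `Option α`, where `none` is the variable `v`, which has to occur. -/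
def VarWordSeq (α : Type*) : Type _ :=
  {X : ℕ → List (Option α) // (∀ n, none ∈ X n) ∧ RapidlyIncreasing X}

/-- The evaluation `x[l]` of a variable word at a letter `l`. -/
def eval {α : Type*} (x : List (Option α)) (l : α) : List α :=
  x.map fun c => c.getD l

/-- The evaluation `x[l]` of a variable word at `l`, a letter or the variable (`x[v] = x`). -/
def evalVar {α : Type*} (x : List (Option α)) (l : Option α) : List (Option α) :=
  x.map fun c => c.elim l some

/-- `w` is the word `x_{n_0}[l_0] ⌢ ⋯ ⌢ x_{n_k}[l_k]` for some letters `l_i ∈ L_{n_i}`, where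
`s = {n_0 < ⋯ < n_k}` is nonempty: `w` lies in the combinatorial subspace `[X]_L`
and has support `s` in `X`. -/
def IsSupp {α : Type*} (L : ℕ → Finset α) (X : VarWordSeq α) (w : List α)
    (s : Finset ℕ) : Prop :=
  s.Nonempty ∧ ∃ l : ℕ → α, (∀ n ∈ s, l n ∈ L n) ∧
    w = (s.sort (· ≤ ·)).flatMap fun n => eval (X.1 n) (l n)

/-- `w` is the variable word `x_{n_0}[l_0] ⌢ ⋯ ⌢ x_{n_k}[l_k]` for some `l_i ∈ L_{n_i} ∪ {v}`,
where `s = {n_0 < ⋯ < n_k}` is nonempty: `w` lies in the combinatorial subspace `[X]_{Lv}`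
and has support `s` in `X`. -/
def IsSuppVar {α : Type*} (L : ℕ → Finset α) (X : VarWordSeq α) (w : List (Option α))
    (s : Finset ℕ) : Prop :=
  s.Nonempty ∧ none ∈ w ∧ ∃ l : ℕ → Option α, (∀ n ∈ s, l n ∈ Finset.insertNone (L n)) ∧
    w = (s.sort (· ≤ ·)).flatMap fun n => evalVar (X.1 n) (l n)

theorem RapidlyIncreasing.finset_eq {β : Type*} {x : ℕ → List β} (hx : RapidlyIncreasing x)
    (N : ℕ) : ∀ s t : Finset ℕ, s ⊆ Finset.range N → t ⊆ Finset.range N →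
      ∑ n ∈ s, (x n).length = ∑ n ∈ t, (x n).length → s = t := by
  induction N with
  | zero =>
    intro s t hs ht _
    rw [Finset.range_zero, Finset.subset_empty] at hs ht
    rw [hs, ht]
  | succ N ih =>
    intro s t hs ht h
    have key : ∀ u : Finset ℕ, u ⊆ Finset.range (N + 1) →
        u.erase N ⊆ Finset.range N := by
      intro u hu n hn
      have h1 := Finset.mem_range.1 (hu (Finset.mem_of_mem_erase hn))
      have h2 := Finset.ne_of_mem_erase hn
      exact Finset.mem_range.2 (by omega)
    have bound : ∀ u : Finset ℕ, u ⊆ Finset.range N →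
        ∑ n ∈ u, (x n).length < (x N).length := fun u hu =>
      (Finset.sum_le_sum_of_subset hu).trans_lt (hx N)
    by_cases h1 : N ∈ s <;> by_cases h2 : N ∈ t
    · rw [← Finset.add_sum_erase s _ h1, ← Finset.add_sum_erase t _ h2] at h
      rw [← Finset.insert_erase h1, ← Finset.insert_erase h2,
        ih _ _ (key s hs) (key t ht) (Nat.add_left_cancel h)]
    · have := bound t (by have := key t ht; rwa [Finset.erase_eq_of_notMem h2] at this)
      rw [← Finset.add_sum_erase s _ h1] at h
      omega
    · have := bound s (by have := key s hs; rwa [Finset.erase_eq_of_notMem h1] at this)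
      rw [← Finset.add_sum_erase t _ h2] at h
      omega
    · have h3 := key s hs
      have h4 := key t ht
      rw [Finset.erase_eq_of_notMem h1] at h3
      rw [Finset.erase_eq_of_notMem h2] at h4
      exact ih s t h3 h4 h

theorem RapidlyIncreasing.finset_eq' {β : Type*} {x : ℕ → List β} (hx : RapidlyIncreasing x)
    {s t : Finset ℕ} (h : ∑ n ∈ s, (x n).length = ∑ n ∈ t, (x n).length) : s = t := by
  obtain ⟨N, hN⟩ := (s ∪ t).exists_nat_subset_range
  exact hx.finset_eq N s t (Finset.subset_union_left.trans hN)
    (Finset.subset_union_right.trans hN) h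

theorem length_flatMap_sort {β : Type*} (s : Finset ℕ) (f : ℕ → List β) :
    ((s.sort (· ≤ ·)).flatMap f).length = ∑ n ∈ s, (f n).length := by
  rw [List.length_flatMap, Finset.sum_eq_multiset_sum, ← Finset.sort_eq s (· ≤ ·)]
  rw [Multiset.map_coe, Multiset.sum_coe]

/-- The support of a word in `X` is unique. -/
theorem IsSupp.unique {α : Type*} {L : ℕ → Finset α} {X : VarWordSeq α} {w : List α}
    {s t : Finset ℕ} (hs : IsSupp L X w s) (ht : IsSupp L X w t) : s = t := by
  obtain ⟨-, l, -, h⟩ := hs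
  obtain ⟨-, m, -, h'⟩ := ht
  apply X.2.2.finset_eq'
  have := congrArg List.length (h.symm.trans h')
  simpa only [length_flatMap_sort, eval, List.length_map] using this

/-- The support of a variable word in `X` is unique. -/
theorem IsSuppVar.unique {α : Type*} {L : ℕ → Finset α} {X : VarWordSeq α}
    {w : List (Option α)} {s t : Finset ℕ} (hs : IsSuppVar L X w s) (ht : IsSuppVar L X w t) :
    s = t := by
  obtain ⟨-, -, l, -, h⟩ := hs
  obtain ⟨-, -, m, -, h'⟩ := ht
  apply X.2.2.finset_eq'
  have := congrArg List.length (h.symm.trans h')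
  simpa only [length_flatMap_sort, evalVar, List.length_map] using this

/-- `Y ≤ X`: `Y` is a block subsequence of `X`, that is, all `y_n` lie in `[X]_{Lv}` and
`max (supp_X y_n) < min (supp_X y_m)` for `n < m`. -/
def BlockLE {α : Type*} (L : ℕ → Finset α) (Y X : VarWordSeq α) : Prop :=
  ∃ S : ℕ → Finset ℕ, (∀ n, IsSuppVar L X (Y.1 n) (S n)) ∧
    ∀ n m, n < m → ∀ i ∈ S n, ∀ j ∈ S m, i < j

/-- `A ≤⁰ X`: all words of `A` lie in `[X]_L`, and their supports in `X` form a block sequence. -/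
def BlockLE₀ {α : Type*} (L : ℕ → Finset α) (A : WordSeq α) (X : VarWordSeq α) : Prop :=
  ∃ S : ℕ → Finset ℕ, (∀ n, IsSupp L X (A.1 n) (S n)) ∧
    ∀ n m, n < m → ∀ i ∈ S n, ∀ j ∈ S m, i < j

/-- `a ≤⁰_fin (x_0, …, x_{k-1})`: the words of the finite sequence `a` are built from
`x_0, …, x_{k-1}`, with supports that form a block sequence. -/
def FinLE₀ {α : Type*} (L : ℕ → Finset α) (a : List (List α)) (X : VarWordSeq α)
    (k : ℕ) : Prop :=
  ∃ S : ℕ → Finset ℕ,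
    (∀ n (hn : n < a.length), IsSupp L X a[n] (S n) ∧ S n ⊆ Finset.range k) ∧
    ∀ n m, n < m → m < a.length → ∀ i ∈ S n, ∀ j ∈ S m, i < j

/-- The depth of `a` in `Y`: the least `k` with `a ≤⁰_fin (y_0, …, y_{k-1})`. It is used only
when the basic set `[a, Y]` is nonempty, and then such a `k` exists. -/
noncomputable def depth {α : Type*} (L : ℕ → Finset α) (Y : VarWordSeq α)
    (a : List (List α)) : ℕ :=
  sInf {k | FinLE₀ L a Y k}

/-- The initial segment `(x_0, …, x_{n-1})` of a sequence. -/
def initSeg {β : Type*} (x : ℕ → β) (n : ℕ) : List β :=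
  (List.range n).map x

/-- The basic set `[a, Y]` of all `A ≤⁰ Y` that have `a` as an initial segment. -/
def basic {α : Type*} (L : ℕ → Finset α) (a : List (List α)) (Y : VarWordSeq α) :
    Set (WordSeq α) :=
  {A | BlockLE₀ L A Y ∧ ∃ n, initSeg A.1 n = a}

/-- The basic set `[n, Y]` of all `X ≤ Y` that have `(y_0, …, y_{n-1})` as an initial segment. -/
def basicVar {α : Type*} (L : ℕ → Finset α) (n : ℕ) (Y : VarWordSeq α) :
    Set (VarWordSeq α) :=
  {X | BlockLE L X Y ∧ ∃ m, initSeg X.1 m = initSeg Y.1 n}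

/-- The family of nonempty perfect subsets of the Cantor space. -/
def perfectSets : Set (Set (ℕ → Bool)) :=
  {Q | Perfect Q ∧ Q.Nonempty}

def PerfectlyRamsey {α : Type*} (L : ℕ → Finset α) (Λ : Set ((ℕ → Bool) × WordSeq α)) : Prop :=
  ∀ Q ∈ perfectSets, ∀ (a : List (List α)) (Y : VarWordSeq α), (basic L a Y).Nonempty →
    ∃ M ∈ perfectSets, M ⊆ Q ∧ ∃ X ∈ basicVar L (depth L Y a) Y, (basic L a X).Nonempty ∧
      (M ×ˢ basic L a X ⊆ Λ ∨ M ×ˢ basic L a X ⊆ Λᶜ)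

def PerfectlyRamseyNull {α : Type*} (L : ℕ → Finset α) (Λ : Set ((ℕ → Bool) × WordSeq α)) :
    Prop :=
  ∀ Q ∈ perfectSets, ∀ (a : List (List α)) (Y : VarWordSeq α), (basic L a Y).Nonempty →
    ∃ M ∈ perfectSets, M ⊆ Q ∧ ∃ X ∈ basicVar L (depth L Y a) Y, (basic L a X).Nonempty ∧
      M ×ˢ basic L a X ⊆ Λᶜ

/-- The Baire property with respect to products of perfect sets and basic sets. -/
def PerfectlyBaire {α : Type*} (L : ℕ → Finset α) (Λ : Set ((ℕ → Bool) × WordSeq α)) : Prop :=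
  ∀ Q ∈ perfectSets, ∀ (a : List (List α)) (Y : VarWordSeq α), (basic L a Y).Nonempty →
    ∃ M ∈ perfectSets, M ⊆ Q ∧ ∃ (b : List (List α)) (X : VarWordSeq α),
      (basic L b X).Nonempty ∧ basic L b X ⊆ basic L a Y ∧
      (M ×ˢ basic L b X ⊆ Λ ∨ M ×ˢ basic L b X ⊆ Λᶜ)

/-- Meagerness with respect to products of perfect sets and basic sets. -/
def PerfectlyMeager {α : Type*} (L : ℕ → Finset α) (Λ : Set ((ℕ → Bool) × WordSeq α)) : Prop :=
  ∀ Q ∈ perfectSets, ∀ (a : List (List α)) (Y : VarWordSeq α), (basic L a Y).Nonempty →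
    ∃ M ∈ perfectSets, M ⊆ Q ∧ ∃ (b : List (List α)) (X : VarWordSeq α),
      (basic L b X).Nonempty ∧ basic L b X ⊆ basic L a Y ∧ M ×ˢ basic L b X ⊆ Λᶜ

end HalesJewettSpace

/-! The proof is combinatorial forcing, carried out simultaneously on a perfect set `M` and a
sequence `X`. A triple `(M, b, X)` decides `Λ` if `M × [b, X]` lies in `Λ` or in its complement. It
rejects `b` if no perfect `N ⊆ M` and nonempty `[b, Z] ⊆ [b, X]` decide `Λ`. Both properties are
hereditary, and by amalgamation (`exists_mem_basicVar_subset`) one of them can always be reached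
without changing the terms of `X` below the depth of `b`.

Two engines drive the argument. The parametrized pigeonhole principle `exists_monochromatic` makes a
closed colouring of `M × {words}` constant after shrinking `M` and `X`. It rests on an idempotent
ultrafilter `u` of words that is the image of one ultrafilter `v` of variable words under every
evaluation (`exists_ultrafilter`). Points whose `u`-limit colour is a fixed `i` form an uncountable
set for some `i`, and a Cantor scheme inside that set is built together with the new variable words.
Fusion (`exists_fusion`) turns a hereditary dense property into one that holds for all `b` extending
`a` at once. The price is that it holds only on the pieces of a finite closed cover of `M`, a cover
depending on `b`. This is harmless, since a perfect subset of `M` has a perfect subset inside one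
piece.

Together they show (`exists_decides_or_rejects_succ`) that after shrinking, either `b` is decided or
every one-word extension of `b` is rejected. Fuse this property over all `b`. If `a` is rejected,
then by induction every extension of `a` is rejected, and the Baire property contradicts this by
deciding one of them. So `a` is not rejected, and amalgamation supplies the required `X`. In the
null case the alternative inside `Λ` is excluded by meagerness. The converse implications take `b =
a`. -/

namespace HalesJewettSpace

/-! ### Concatenations over finite index sets and block sequences -/

section Concatenation

variable {β γ : Type*}

/-- The concatenation of the words `f n`, `n ∈ s`, in increasing order of `n`. -/
def cat (f : ℕ → List β) (s : Finset ℕ) : List β :=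
  (s.sort (· ≤ ·)).flatMap f

theorem cat_empty (f : ℕ → List β) : cat f ∅ = [] := by simp [cat]

theorem cat_singleton (f : ℕ → List β) (n : ℕ) : cat f {n} = f n := by simp [cat]

theorem sort_union {s t : Finset ℕ} (h : ∀ i ∈ s, ∀ j ∈ t, i < j) :
    (s ∪ t).sort (· ≤ ·) = s.sort (· ≤ ·) ++ t.sort (· ≤ ·) := by
  have hp : ((s.sort (· ≤ ·)) ++ (t.sort (· ≤ ·))).Pairwise (· < ·) := by
    rw [List.pairwise_append]
    refine ⟨Finset.sortedLT_sort s |>.pairwise, Finset.sortedLT_sort t |>.pairwise, ?_⟩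
    intro a ha b hb
    exact h a ((Finset.mem_sort _).1 ha) b ((Finset.mem_sort _).1 hb)
  refine List.Perm.eq_of_pairwise (le := (· < ·)) (fun a b _ _ h1 h2 => (lt_asymm h1 h2).elim)
    (Finset.sortedLT_sort _).pairwise hp ?_
  rw [List.perm_ext_iff_of_nodup (Finset.sort_nodup _ _) (hp.imp fun h => h.ne)]
  simp

theorem cat_union (f : ℕ → List β) {s t : Finset ℕ} (h : ∀ i ∈ s, ∀ j ∈ t, i < j) :
    cat f (s ∪ t) = cat f s ++ cat f t := by
  rw [cat, sort_union h, List.flatMap_append, cat, cat]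

theorem cat_insert (f : ℕ → List β) {s : Finset ℕ} {m : ℕ} (h : ∀ i ∈ s, i < m) :
    cat f (insert m s) = cat f s ++ f m := by
  rw [Finset.insert_eq, Finset.union_comm, cat_union f (by simpa using h), cat_singleton]

theorem cat_congr {f g : ℕ → List β} {s : Finset ℕ} (h : ∀ n ∈ s, f n = g n) :
    cat f s = cat g s :=
  List.flatMap_congr fun n hn => h n ((Finset.mem_sort _).1 hn)

theorem length_cat (f : ℕ → List β) (s : Finset ℕ) :
    (cat f s).length = ∑ n ∈ s, (f n).length :=
  length_flatMap_sort s f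

theorem map_cat (φ : β → γ) (f : ℕ → List β) (s : Finset ℕ) :
    (cat f s).map φ = cat (fun n => (f n).map φ) s := by
  rw [cat, cat, List.map_flatMap]

theorem mem_cat {f : ℕ → List β} {s : Finset ℕ} {b : β} :
    b ∈ cat f s ↔ ∃ n ∈ s, b ∈ f n := by
  simp [cat]

/-- `w` is a concatenation of words `g n ∈ P n`, `n ∈ s`, with `s` nonempty. -/
def Comb (P : ℕ → Set (List β)) (w : List β) (s : Finset ℕ) : Prop :=
  s.Nonempty ∧ ∃ g : ℕ → List β, (∀ n ∈ s, g n ∈ P n) ∧ w = cat g s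

theorem Comb.single {P : ℕ → Set (List β)} {w : List β} {n : ℕ} (h : w ∈ P n) :
    Comb P w {n} :=
  ⟨Finset.singleton_nonempty n, fun _ => w, by simpa using h, by rw [cat_singleton]⟩

theorem Comb.append {P : ℕ → Set (List β)} {w w' : List β} {s t : Finset ℕ}
    (hw : Comb P w s) (hw' : Comb P w' t) (h : ∀ i ∈ s, ∀ j ∈ t, i < j) :
    Comb P (w ++ w') (s ∪ t) := by
  obtain ⟨hs, g, hg, rfl⟩ := hw
  obtain ⟨ht, g', hg', rfl⟩ := hw'
  have hd : ∀ j ∈ t, j ∉ s := fun j hj hj' => lt_irrefl _ (h j hj' j hj)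
  refine ⟨hs.mono Finset.subset_union_left, fun n => if n ∈ s then g n else g' n, ?_, ?_⟩
  · intro n hn
    by_cases hns : n ∈ s
    · simpa [hns] using hg n hns
    · simpa [hns] using hg' n ((Finset.mem_union.1 hn).resolve_left hns)
  · rw [cat_union _ h]
    congr 1
    · exact cat_congr fun n hn => by simp [hn]
    · exact cat_congr fun n hn => by simp [hd n hn]

theorem Comb.bind {P : ℕ → Set (List β)} {h : ℕ → List β} {S : ℕ → Finset ℕ}
    {T : Finset ℕ} (hT : T.Nonempty) (hS : ∀ n ∈ T, Comb P (h n) (S n))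
    (hb : ∀ n ∈ T, ∀ m ∈ T, n < m → ∀ i ∈ S n, ∀ j ∈ S m, i < j) :
    Comb P (cat h T) (T.biUnion S) := by
  induction T using Finset.induction_on_max with
  | empty => simp at hT
  | insert m T hm ih =>
    rw [cat_insert h hm]
    rcases T.eq_empty_or_nonempty with rfl | hT'
    · simpa [cat_empty] using hS m (by simp)
    · rw [Finset.biUnion_insert, Finset.union_comm]
      refine (ih hT' (fun n hn => hS n (by simp [hn])) fun n hn k hk =>
        hb n (by simp [hn]) k (by simp [hk])).append (hS m (by simp)) ?_
      intro i hi j hj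
      obtain ⟨n, hn, hi⟩ := Finset.mem_biUnion.1 hi
      exact hb n (by simp [hn]) m (by simp) (hm n hn) i hi j hj

theorem Comb.imp {P Q : ℕ → Set (List β)} {w : List β} {s : Finset ℕ}
    (h : Comb P w s) (hPQ : ∀ n ∈ s, P n ⊆ Q n) : Comb Q w s := by
  obtain ⟨hs, g, hg, rfl⟩ := h
  exact ⟨hs, g, fun n hn => hPQ n hn (hg n hn), rfl⟩

theorem Comb.map {P : ℕ → Set (List β)} {Q : ℕ → Set (List γ)} {w : List β} {s : Finset ℕ}
    (φ : β → γ) (h : Comb P w s) (hPQ : ∀ n ∈ s, ∀ x ∈ P n, x.map φ ∈ Q n) :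
    Comb Q (w.map φ) s := by
  obtain ⟨hs, g, hg, rfl⟩ := h
  exact ⟨hs, fun n => (g n).map φ, fun n hn => hPQ n hn _ (hg n hn), map_cat φ g s⟩

theorem Comb.length {P : ℕ → Set (List β)} {ℓ : ℕ → ℕ} {w : List β} {s : Finset ℕ}
    (h : Comb P w s) (hP : ∀ n, ∀ x ∈ P n, x.length = ℓ n) : w.length = ∑ n ∈ s, ℓ n := by
  obtain ⟨hs, g, hg, rfl⟩ := h
  rw [length_cat]
  exact Finset.sum_congr rfl fun n hn => hP n _ (hg n hn)

/-- The sets of a sequence are in increasing block position. -/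
def IsBlock (S : ℕ → Finset ℕ) : Prop :=
  ∀ n m, n < m → ∀ i ∈ S n, ∀ j ∈ S m, i < j

/-- This makes `≤` transitive: a letter of `L n` substituted into `y_n` enters the words `x_i` only
for `i ∈ S n`. Then `n ≤ i`, so monotonicity of `L` admits the letter there. -/
theorem IsBlock.le {S : ℕ → Finset ℕ} (h : IsBlock S) (hne : ∀ n, (S n).Nonempty) :
    ∀ n, ∀ i ∈ S n, n ≤ i := by
  intro n
  induction n with
  | zero => simp
  | succ n ih =>
    intro i hi
    obtain ⟨j, hj⟩ := hne n
    have := h n (n + 1) (by omega) j hj i hi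
    have := ih j hj
    omega

theorem IsBlock.comp {S : ℕ → Finset ℕ} (h : IsBlock S) {T : ℕ → Finset ℕ} (hT : IsBlock T) :
    IsBlock fun n => (T n).biUnion S := by
  intro n m hnm i hi j hj
  obtain ⟨k, hk, hi⟩ := Finset.mem_biUnion.1 hi
  obtain ⟨l, hl, hj⟩ := Finset.mem_biUnion.1 hj
  exact h k l (hT n m hnm k hk l hl) i hi j hj

/-- Words whose lengths are sums of a rapidly increasing sequence over blocks are rapidly
increasing. -/
theorem rapidlyIncreasing_of_isBlock {x : ℕ → List β} (hx : RapidlyIncreasing x)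
    {A : ℕ → List γ} {S : ℕ → Finset ℕ} (hS : IsBlock S) (hne : ∀ n, (S n).Nonempty)
    (hA : ∀ n, (A n).length = ∑ j ∈ S n, (x j).length) : RapidlyIncreasing A := by
  intro n
  obtain ⟨m, hm⟩ := hne n
  calc ∑ i ∈ Finset.range n, (A i).length
      = ∑ i ∈ Finset.range n, ∑ j ∈ S i, (x j).length := Finset.sum_congr rfl fun i _ => hA i
    _ = ∑ j ∈ (Finset.range n).biUnion S, (x j).length := by
        rw [Finset.sum_biUnion]
        intro i _ j _ hij
        refine Finset.disjoint_left.2 fun k hk hk' => ?_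
        rcases lt_or_gt_of_ne hij with h | h
        · exact lt_irrefl _ (hS i j h k hk k hk')
        · exact lt_irrefl _ (hS j i h k hk' k hk)
    _ ≤ ∑ j ∈ Finset.range m, (x j).length := by
        refine Finset.sum_le_sum_of_subset fun j hj => ?_
        obtain ⟨i, hi, hj⟩ := Finset.mem_biUnion.1 hj
        exact Finset.mem_range.2 (hS i n (Finset.mem_range.1 hi) j hj m hm)
    _ < (x m).length := hx m
    _ ≤ ∑ j ∈ S n, (x j).length :=
        Finset.single_le_sum (f := fun j => (x j).length) (fun _ _ => Nat.zero_le _) hm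
    _ = (A n).length := (hA n).symm

end Concatenation

/-! ### Supports and transitivity of the block orders -/

section Supports

variable {α : Type*} {L : ℕ → Finset α} {X Y Z : VarWordSeq α}

/-- The words `x_n[l]` with `l ∈ L_n`. -/
def pieces (L : ℕ → Finset α) (X : VarWordSeq α) (n : ℕ) : Set (List α) :=
  {w | ∃ l ∈ L n, w = eval (X.1 n) l}

/-- The words `x_n[l]` with `l ∈ L_n ∪ {v}`. -/
def piecesVar (L : ℕ → Finset α) (X : VarWordSeq α) (n : ℕ) : Set (List (Option α)) :=
  {w | ∃ l ∈ Finset.insertNone (L n), w = evalVar (X.1 n) l}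

theorem isSupp_iff {w : List α} {s : Finset ℕ} : IsSupp L X w s ↔ Comb (pieces L X) w s := by
  refine and_congr_right fun hs => ⟨?_, ?_⟩
  · rintro ⟨l, hl, rfl⟩
    exact ⟨_, fun n hn => ⟨l n, hl n hn, rfl⟩, rfl⟩
  · rintro ⟨g, hg, rfl⟩
    obtain ⟨m, hm⟩ := hs
    obtain ⟨l₀, -, -⟩ := hg m hm
    have : ∀ n, ∃ l, n ∈ s → l ∈ L n ∧ g n = eval (X.1 n) l := fun n => by
      by_cases hn : n ∈ s
      · obtain ⟨l, hl, h⟩ := hg n hn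
        exact ⟨l, fun _ => ⟨hl, h⟩⟩
      · exact ⟨l₀, fun h => (hn h).elim⟩
    choose l hl using this
    exact ⟨l, fun n hn => (hl n hn).1, cat_congr fun n hn => (hl n hn).2⟩

theorem isSuppVar_iff {w : List (Option α)} {s : Finset ℕ} :
    IsSuppVar L X w s ↔ none ∈ w ∧ Comb (piecesVar L X) w s := by
  constructor
  · rintro ⟨hs, hw, l, hl, rfl⟩
    exact ⟨hw, hs, _, fun n hn => ⟨l n, hl n hn, rfl⟩, rfl⟩
  · rintro ⟨hw, hs, g, hg, rfl⟩
    have : ∀ n, ∃ l, n ∈ s → l ∈ Finset.insertNone (L n) ∧ g n = evalVar (X.1 n) l := fun n => by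
      by_cases hn : n ∈ s
      · obtain ⟨l, hl, h⟩ := hg n hn
        exact ⟨l, fun _ => ⟨hl, h⟩⟩
      · exact ⟨none, fun h => (hn h).elim⟩
    choose l hl using this
    exact ⟨hs, hw, l, fun n hn => (hl n hn).1, cat_congr fun n hn => (hl n hn).2⟩

theorem evalVar_none (x : List (Option α)) : evalVar x none = x := by
  rw [evalVar]
  conv_rhs => rw [← List.map_id x]
  refine List.map_congr_left fun c _ => ?_
  cases c <;> rfl

theorem evalVar_evalVar (x : List (Option α)) (l m : Option α) :
    evalVar (evalVar x l) m = evalVar x (l.elim m some) := by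
  rw [evalVar, evalVar, evalVar, List.map_map]
  refine List.map_congr_left fun c _ => ?_
  cases c <;> rfl

theorem eval_evalVar (x : List (Option α)) (l : Option α) (m : α) :
    eval (evalVar x l) m = eval x (l.getD m) := by
  rw [evalVar, eval, eval, List.map_map]
  refine List.map_congr_left fun c _ => ?_
  cases c <;> cases l <;> rfl

theorem length_eval (x : List (Option α)) (l : α) : (eval x l).length = x.length :=
  List.length_map _

theorem length_evalVar (x : List (Option α)) (l : Option α) :
    (evalVar x l).length = x.length :=
  List.length_map _

theorem IsSupp.length {w : List α} {s : Finset ℕ} (h : IsSupp L X w s) :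
    w.length = ∑ j ∈ s, (X.1 j).length :=
  (isSupp_iff.1 h).length fun n x ⟨l, _, hx⟩ => by rw [hx, length_eval]

theorem IsSuppVar.length {w : List (Option α)} {s : Finset ℕ} (h : IsSuppVar L X w s) :
    w.length = ∑ j ∈ s, (X.1 j).length :=
  (isSuppVar_iff.1 h).2.length fun n x ⟨l, _, hx⟩ => by rw [hx, length_evalVar]

theorem IsSuppVar.eval {w : List (Option α)} {s : Finset ℕ} (h : IsSuppVar L X w s) {l : α}
    (hl : ∀ n ∈ s, l ∈ L n) : IsSupp L X (eval w l) s := by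
  rw [isSupp_iff]
  refine (isSuppVar_iff.1 h).2.map _ ?_
  rintro n hn _ ⟨m, hm, rfl⟩
  refine ⟨m.getD l, ?_, eval_evalVar _ _ _⟩
  cases m with
  | none => exact hl n hn
  | some m => simpa using hm

theorem IsSuppVar.evalVar {w : List (Option α)} {s : Finset ℕ} (h : IsSuppVar L X w s)
    {l : Option α} (hl : ∀ n ∈ s, l ∈ Finset.insertNone (L n)) :
    Comb (piecesVar L X) (evalVar w l) s := by
  refine (isSuppVar_iff.1 h).2.map _ ?_
  rintro n hn _ ⟨m, hm, rfl⟩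
  refine ⟨m.elim l some, ?_, evalVar_evalVar _ _ _⟩
  cases m with
  | none => exact hl n hn
  | some m => exact hm

theorem isSuppVar_self (X : VarWordSeq α) (n : ℕ) : IsSuppVar L X (X.1 n) {n} :=
  isSuppVar_iff.2 ⟨X.2.1 n, .single ⟨none, by simp, (evalVar_none _).symm⟩⟩

theorem isBlock_singleton : IsBlock fun n => {n} := by
  intro n m h i hi j hj
  rw [Finset.mem_singleton] at hi hj
  omega

theorem BlockLE.refl (X : VarWordSeq α) : BlockLE L X X :=
  ⟨fun n => {n}, isSuppVar_self X, isBlock_singleton⟩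

theorem IsSupp.trans (hmono : Monotone L) {S : ℕ → Finset ℕ}
    (hS : ∀ n, IsSuppVar L X (Y.1 n) (S n)) (hb : IsBlock S) {w : List α} {s : Finset ℕ}
    (h : IsSupp L Y w s) : IsSupp L X w (s.biUnion S) := by
  obtain ⟨hs, l, hl, rfl⟩ := h
  rw [isSupp_iff]
  refine Comb.bind hs (fun n hn => ?_) fun n _ m _ => hb n m
  exact isSupp_iff.1 ((hS n).eval fun m hm => hmono (hb.le (fun n => (hS n).1) n m hm) (hl n hn))

theorem IsSuppVar.trans (hmono : Monotone L) {S : ℕ → Finset ℕ}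
    (hS : ∀ n, IsSuppVar L X (Y.1 n) (S n)) (hb : IsBlock S) {w : List (Option α)}
    {s : Finset ℕ} (h : IsSuppVar L Y w s) : IsSuppVar L X w (s.biUnion S) := by
  obtain ⟨hs, hw, l, hl, rfl⟩ := h
  rw [isSuppVar_iff]
  refine ⟨hw, Comb.bind hs (fun n hn => ?_) fun n _ m _ => hb n m⟩
  exact (hS n).evalVar fun m hm => Finset.insertNone.monotone
    (hmono (hb.le (fun n => (hS n).1) n m hm)) (hl n hn)

theorem BlockLE.trans (hmono : Monotone L) (hZY : BlockLE L Z Y) (hYX : BlockLE L Y X) :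
    BlockLE L Z X := by
  obtain ⟨T, hT, hT'⟩ := hZY
  obtain ⟨S, hS, hS'⟩ := hYX
  exact ⟨fun n => (T n).biUnion S, fun n => (hT n).trans hmono hS hS', IsBlock.comp hS' hT'⟩

theorem BlockLE₀.trans (hmono : Monotone L) {A : WordSeq α} (hAY : BlockLE₀ L A Y)
    (hYX : BlockLE L Y X) : BlockLE₀ L A X := by
  obtain ⟨T, hT, hT'⟩ := hAY
  obtain ⟨S, hS, hS'⟩ := hYX
  exact ⟨fun n => (T n).biUnion S, fun n => (hT n).trans hmono hS hS', IsBlock.comp hS' hT'⟩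

end Supports

/-! ### Basic sets, depth and tails -/

section BasicSets

variable {α : Type*} {L : ℕ → Finset α} {X Y Z : VarWordSeq α}

theorem initSeg_length {β : Type*} (x : ℕ → β) (n : ℕ) : (initSeg x n).length = n := by
  simp [initSeg]

theorem getElem_initSeg {β : Type*} (x : ℕ → β) (n i : ℕ) (h : i < (initSeg x n).length) :
    (initSeg x n)[i] = x i := by
  simp [initSeg]

theorem initSeg_succ {β : Type*} (x : ℕ → β) (n : ℕ) :
    initSeg x (n + 1) = initSeg x n ++ [x n] := by
  simp [initSeg, List.range_succ]

theorem initSeg_eq_iff {β : Type*} {x : ℕ → β} {n : ℕ} {a : List β} :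
    initSeg x n = a ↔ a.length = n ∧ ∀ i (h : i < a.length), a[i] = x i := by
  constructor
  · rintro rfl
    exact ⟨initSeg_length x n, fun i h => getElem_initSeg x n i h⟩
  · rintro ⟨rfl, h⟩
    refine List.ext_getElem (initSeg_length _ _) fun i h1 h2 => ?_
    rw [getElem_initSeg, h]

theorem initSeg_prefix {β : Type*} (x : ℕ → β) {m n : ℕ} (h : m ≤ n) :
    initSeg x m <+: initSeg x n := by
  obtain ⟨k, rfl⟩ := Nat.exists_eq_add_of_le h
  exact ⟨(List.range k).map fun i => x (m + i), by
    simp only [initSeg, List.range_add, List.map_append, List.map_map]; rfl⟩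

theorem initSeg_of_prefix {β : Type*} {x : ℕ → β} {a b : List β} (hab : a <+: b)
    (hb : initSeg x b.length = b) : initSeg x a.length = a := by
  obtain ⟨c, rfl⟩ := hab
  have h := (initSeg_eq_iff.1 hb).2
  refine initSeg_eq_iff.2 ⟨rfl, fun i hi => ?_⟩
  rw [← h i (by rw [List.length_append]; omega), List.getElem_append_left hi]

theorem mem_basic {a : List (List α)} {A : WordSeq α} :
    A ∈ basic L a Y ↔ BlockLE₀ L A Y ∧ initSeg A.1 a.length = a := by
  refine and_congr_right fun _ => ⟨?_, fun h => ⟨_, h⟩⟩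
  rintro ⟨n, h⟩
  have := (initSeg_eq_iff.1 h).1
  rw [this, h]

theorem mem_basicVar {n : ℕ} :
    X ∈ basicVar L n Y ↔ BlockLE L X Y ∧ ∀ i < n, X.1 i = Y.1 i := by
  refine and_congr_right fun _ => ⟨?_, fun h => ⟨n, ?_⟩⟩
  · rintro ⟨m, h⟩ i hi
    obtain ⟨h1, h2⟩ := initSeg_eq_iff.1 h
    rw [← h2 i (by rw [initSeg_length]; exact hi), getElem_initSeg]
  · refine initSeg_eq_iff.2 ⟨initSeg_length _ _, fun i hi => ?_⟩
    rw [initSeg_length] at hi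
    rw [getElem_initSeg, h i hi]

theorem basicVar_refl (n : ℕ) (X : VarWordSeq α) : X ∈ basicVar L n X :=
  mem_basicVar.2 ⟨.refl X, fun _ _ => rfl⟩

theorem basicVar_trans (hmono : Monotone L) {n : ℕ} (hZ : Z ∈ basicVar L n Y)
    (hY : Y ∈ basicVar L n X) : Z ∈ basicVar L n X := by
  rw [mem_basicVar] at *
  exact ⟨hZ.1.trans hmono hY.1, fun i hi => (hZ.2 i hi).trans (hY.2 i hi)⟩

theorem basicVar_anti {m n : ℕ} (h : m ≤ n) : basicVar L n X ⊆ basicVar L m X := by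
  intro Y hY
  rw [mem_basicVar] at *
  exact ⟨hY.1, fun i hi => hY.2 i (hi.trans_le h)⟩

theorem basic_subset_of_blockLE (hmono : Monotone L) (h : BlockLE L X Y)
    (a : List (List α)) : basic L a X ⊆ basic L a Y := fun _ hA =>
  ⟨hA.1.trans hmono h, hA.2⟩

theorem basic_subset_of_mem (hmono : Monotone L) {n : ℕ} (h : X ∈ basicVar L n Y)
    (a : List (List α)) : basic L a X ⊆ basic L a Y :=
  basic_subset_of_blockLE hmono h.1 a

theorem basic_anti {a b : List (List α)} (h : a <+: b) : basic L b X ⊆ basic L a X := by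
  intro A hA
  rw [mem_basic] at *
  exact ⟨hA.1, initSeg_of_prefix h hA.2⟩

theorem IsSupp.congr {w : List α} {s : Finset ℕ} (h : IsSupp L X w s)
    (hXY : ∀ i ∈ s, X.1 i = Y.1 i) : IsSupp L Y w s := by
  rw [isSupp_iff] at *
  refine h.imp fun n hn => ?_
  rintro _ ⟨l, hl, rfl⟩
  exact ⟨l, hl, by rw [hXY n hn]⟩

theorem FinLE₀.congr {a : List (List α)} {k : ℕ} (h : FinLE₀ L a X k)
    (hXY : ∀ i < k, X.1 i = Y.1 i) : FinLE₀ L a Y k := by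
  obtain ⟨S, hS, hb⟩ := h
  exact ⟨S, fun n hn => ⟨(hS n hn).1.congr fun i hi =>
    hXY i (Finset.mem_range.1 ((hS n hn).2 hi)), (hS n hn).2⟩, hb⟩

theorem FinLE₀.of_prefix {a b : List (List α)} {k : ℕ} (hab : a <+: b)
    (h : FinLE₀ L b X k) : FinLE₀ L a X k := by
  obtain ⟨c, rfl⟩ := hab
  obtain ⟨S, hS, hb⟩ := h
  refine ⟨S, fun n hn => ?_, fun n m hnm hm =>
    hb n m hnm (by rw [List.length_append]; omega)⟩
  have := hS n (by rw [List.length_append]; omega)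
  rwa [List.getElem_append_left hn] at this

theorem exists_finLE₀ {a : List (List α)} (h : (basic L a X).Nonempty) :
    ∃ k, FinLE₀ L a X k := by
  obtain ⟨A, hA⟩ := h
  obtain ⟨⟨S, hS, hb⟩, ha⟩ := mem_basic.1 hA
  have ha := (initSeg_eq_iff.1 ha).2
  refine ⟨((Finset.range a.length).biUnion S).sup id + 1, S, fun n hn => ⟨?_, ?_⟩,
    fun n m hnm _ => hb n m hnm⟩
  · rw [ha n hn]
    exact hS n
  · intro i hi
    have : i ≤ ((Finset.range a.length).biUnion S).sup id :=
      Finset.le_sup (f := id) (Finset.mem_biUnion.2 ⟨n, Finset.mem_range.2 hn, hi⟩)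
    exact Finset.mem_range.2 (by omega)

theorem finLE₀_depth {a : List (List α)} (h : (basic L a X).Nonempty) :
    FinLE₀ L a X (depth L X a) :=
  Nat.sInf_mem (exists_finLE₀ h)

theorem depth_le {a : List (List α)} {k : ℕ} (h : FinLE₀ L a X k) : depth L X a ≤ k :=
  Nat.sInf_le h

theorem depth_mono {a b : List (List α)} (hab : a <+: b) (h : (basic L b X).Nonempty) :
    depth L X a ≤ depth L X b :=
  depth_le ((finLE₀_depth h).of_prefix hab)

theorem depth_congr {a : List (List α)} (h : FinLE₀ L a X (depth L X a))
    (hXY : ∀ i < depth L X a, X.1 i = Y.1 i) : depth L Y a = depth L X a := by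
  refine le_antisymm (depth_le (h.congr hXY)) ?_
  by_contra hlt
  rw [not_le] at hlt
  have h' : FinLE₀ L a Y (depth L Y a) :=
    Nat.sInf_mem (s := {k | FinLE₀ L a Y k}) ⟨_, h.congr hXY⟩
  exact absurd (depth_le (h'.congr fun i hi => (hXY i (hi.trans hlt)).symm)) (not_le.2 hlt)

/-- The words of `[X]_L` with support in `{d, d + 1, …}`. -/
def TailWord (L : ℕ → Finset α) (X : VarWordSeq α) (d : ℕ) (w : List α) : Prop :=
  ∃ s, IsSupp L X w s ∧ ∀ j ∈ s, d ≤ j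

/-- By the block condition, any index `j` in the support of a later word bounds all supports of `a`
strictly. It is therefore an admissible `k` in the definition of depth, and minimality gives `depth
L X a ≤ j`. -/
theorem exists_tail_supports {a : List (List α)} {A : WordSeq α} (hA : A ∈ basic L a X) :
    ∃ S : ℕ → Finset ℕ, (∀ i, IsSupp L X (A.1 (a.length + i)) (S i)) ∧
      (∀ i, ∀ j ∈ S i, depth L X a ≤ j) ∧ IsBlock S := by
  obtain ⟨⟨S, hS, hb⟩, ha⟩ := mem_basic.1 hA
  have ha := (initSeg_eq_iff.1 ha).2
  refine ⟨fun i => S (a.length + i), fun i => hS _, fun i j hj => depth_le ?_,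
    fun n m hnm => hb _ _ (by omega)⟩
  refine ⟨S, fun n hn => ⟨?_, fun k hk => ?_⟩, fun n m hnm _ => hb n m hnm⟩
  · rw [ha n hn]
    exact hS n
  · exact Finset.mem_range.2 (hb n (a.length + i) (by omega) k hk j hj)

theorem mem_basic_of_tail {a : List (List α)} {d : ℕ} (h : FinLE₀ L a X d) {A : WordSeq α}
    (hA : initSeg A.1 a.length = a) {S : ℕ → Finset ℕ}
    (hS : ∀ i, IsSupp L X (A.1 (a.length + i)) (S i)) (hd : ∀ i, ∀ j ∈ S i, d ≤ j)
    (hb : IsBlock S) : A ∈ basic L a X := by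
  obtain ⟨T, hT, hTb⟩ := h
  have ha := (initSeg_eq_iff.1 hA).2
  refine mem_basic.2 ⟨⟨fun n => if n < a.length then T n else S (n - a.length), ?_, ?_⟩, hA⟩
  · intro n
    by_cases hn : n < a.length
    · simp only [hn, if_true, ← ha n hn]
      exact (hT n hn).1
    · simp only [hn, if_false]
      have := hS (n - a.length)
      rwa [show a.length + (n - a.length) = n by omega] at this
  · intro n m hnm
    by_cases hm : m < a.length
    · simp only [hnm.trans hm, hm, if_true]
      exact hTb n m hnm hm
    · by_cases hn : n < a.length
      · simp only [hn, hm, if_true, if_false]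
        intro i hi j hj
        exact (Finset.mem_range.1 ((hT n hn).2 hi)).trans_le (hd _ j hj)
      · simp only [hn, hm, if_false]
        exact hb _ _ (by omega)

/-- Given `a` built from `x_0, …, x_{d-1}`, a sequence of words with block supports beyond `d`
extends `a` to an element of `[a, X]`. -/
theorem exists_mem_basic {a : List (List α)} {d : ℕ} (h : FinLE₀ L a X d) {w : ℕ → List α}
    {S : ℕ → Finset ℕ} (hS : ∀ i, IsSupp L X (w i) (S i)) (hd : ∀ i, ∀ j ∈ S i, d ≤ j)
    (hb : IsBlock S) : ∃ A ∈ basic L a X, ∀ i, A.1 (a.length + i) = w i := by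
  obtain ⟨T, hT, hTb⟩ := h
  let B : ℕ → List α := fun n => if hn : n < a.length then a[n] else w (n - a.length)
  let U : ℕ → Finset ℕ := fun n => if n < a.length then T n else S (n - a.length)
  have hB : ∀ n, IsSupp L X (B n) (U n) := fun n => by
    by_cases hn : n < a.length
    · simp only [B, U, hn, dite_true, if_true]
      exact (hT n hn).1
    · simp only [B, U, hn, dite_false, if_false]
      exact hS _
  have hU : IsBlock U := by
    intro n m hnm
    by_cases hm : m < a.length
    · simp only [U, hnm.trans hm, hm, if_true]
      exact hTb n m hnm hm
    · by_cases hn : n < a.length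
      · simp only [U, hn, hm, if_true, if_false]
        intro i hi j hj
        exact (Finset.mem_range.1 ((hT n hn).2 hi)).trans_le (hd _ j hj)
      · simp only [U, hn, hm, if_false]
        exact hb _ _ (by omega)
  refine ⟨⟨B, rapidlyIncreasing_of_isBlock X.2.2 hU (fun n => (hB n).1) fun n =>
    (hB n).length⟩, mem_basic.2 ⟨⟨U, hB, hU⟩, ?_⟩, fun i => ?_⟩
  · exact initSeg_eq_iff.2 ⟨rfl, fun i hi => by simp [B, hi]⟩
  · simp [B]

theorem basic_nonempty_of_finLE₀ (hmono : Monotone L) {l : α} {n : ℕ} (hl : l ∈ L n)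
    {a : List (List α)} {d : ℕ} (h : FinLE₀ L a X d) : (basic L a X).Nonempty := by
  obtain ⟨A, hA, -⟩ := exists_mem_basic h (w := fun i => eval (X.1 (max d n + i)) l)
    (S := fun i => {max d n + i}) (fun i => (isSuppVar_self X _).eval fun m hm => by
      rw [Finset.mem_singleton] at hm
      exact hmono (by omega) hl) (fun i j hj => by rw [Finset.mem_singleton] at hj; omega)
    (fun n m hnm i hi j hj => by rw [Finset.mem_singleton] at hi hj; omega)
  exact ⟨A, hA⟩

theorem exists_letter {a : List (List α)} (h : (basic L a X).Nonempty) : ∃ n, ∃ l, l ∈ L n := by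
  obtain ⟨A, ⟨S, hS, -⟩, -⟩ := h
  obtain ⟨⟨n, hn⟩, l, hl, -⟩ := hS 0
  exact ⟨n, l n, hl n hn⟩

/-- Once a letter exists, `[a, Y]` is nonempty as soon as `a` is built from an initial segment of
`Y`. Hence nonemptiness and depth survive every change of `X` beyond `depth L X a`. -/
theorem basic_nonempty_of_mem (hmono : Monotone L) {a : List (List α)}
    (h : (basic L a X).Nonempty) (hY : Y ∈ basicVar L (depth L X a) X) :
    (basic L a Y).Nonempty ∧ depth L Y a = depth L X a := by
  have hYX := (mem_basicVar.1 hY).2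
  obtain ⟨n, l, hl⟩ := exists_letter h
  have h0 := finLE₀_depth h
  exact ⟨basic_nonempty_of_finLE₀ hmono hl (h0.congr fun i hi => (hYX i hi).symm),
    depth_congr h0 fun i hi => (hYX i hi).symm⟩

theorem tailWord_of_mem_basic {a : List (List α)} {A : WordSeq α} (hA : A ∈ basic L a X) :
    TailWord L X (depth L X a) (A.1 a.length) ∧ A ∈ basic L (a ++ [A.1 a.length]) X := by
  obtain ⟨S, hS, hd, -⟩ := exists_tail_supports hA
  refine ⟨⟨S 0, hS 0, hd 0⟩, hA.1, a.length + 1, ?_⟩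
  rw [initSeg_succ, (mem_basic.1 hA).2]

theorem tailWord_of_basic_nonempty {a : List (List α)} {w : List α}
    (h : (basic L (a ++ [w]) X).Nonempty) : TailWord L X (depth L X a) w := by
  obtain ⟨A, hA⟩ := h
  have := (tailWord_of_mem_basic (basic_anti (List.prefix_append a [w]) hA)).1
  have h2 := (initSeg_eq_iff.1 (mem_basic.1 hA).2).2 a.length (by simp)
  simp only [List.getElem_concat_length] at h2
  rwa [h2]

theorem basic_nonempty_of_tailWord (hmono : Monotone L) {a : List (List α)} {w : List α}
    (h : (basic L a X).Nonempty) (hw : TailWord L X (depth L X a) w) :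
    (basic L (a ++ [w]) X).Nonempty := by
  obtain ⟨n, l, hl⟩ := exists_letter h
  obtain ⟨T, hT, hTb⟩ := finLE₀_depth h
  obtain ⟨s, hs, hd⟩ := hw
  refine basic_nonempty_of_finLE₀ hmono hl (d := max (depth L X a) (s.sup id + 1))
    ⟨fun n => if n < a.length then T n else s, fun n hn => ?_, fun n m hnm hm => ?_⟩
  · by_cases hna : n < a.length
    · simp only [hna, if_true, List.getElem_append_left]
      exact ⟨(hT n hna).1, (hT n hna).2.trans (Finset.range_mono (le_max_left _ _))⟩
    · have : n = a.length := by simp at hn; omega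
      subst this
      simp only [lt_irrefl, if_false, List.getElem_concat_length]
      refine ⟨hs, fun i hi => Finset.mem_range.2 ?_⟩
      have := Finset.le_sup (f := id) hi
      simp only [id] at this
      omega
  · have hna : n < a.length := by simp at hm; omega
    by_cases hma : m < a.length
    · simp only [hna, hma, if_true]
      exact hTb n m hnm hma
    · simp only [hna, hma, if_true, if_false]
      intro i hi j hj
      exact (Finset.mem_range.1 ((hT n hna).2 hi)).trans_le (hd j hj)

/-- Replacing the terms of `X` from the `d`-th on by a block sequence of variable words with
supports beyond `d`. -/
theorem exists_mem_basicVar (d : ℕ) {z : ℕ → List (Option α)} {S : ℕ → Finset ℕ}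
    (hS : ∀ i, IsSuppVar L X (z i) (S i)) (hd : ∀ i, ∀ j ∈ S i, d ≤ j) (hb : IsBlock S) :
    ∃ Y ∈ basicVar L d X, ∀ i, Y.1 (d + i) = z i := by
  let y : ℕ → List (Option α) := fun n => if n < d then X.1 n else z (n - d)
  let U : ℕ → Finset ℕ := fun n => if n < d then {n} else S (n - d)
  have hy : ∀ n, IsSuppVar L X (y n) (U n) := fun n => by
    by_cases hn : n < d
    · simp only [y, U, hn, if_true]
      exact isSuppVar_self X n
    · simp only [y, U, hn, if_false]
      exact hS _
  have hU : IsBlock U := by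
    intro n m hnm i hi j hj
    by_cases hm : m < d
    · simp only [U, hnm.trans hm, hm, if_true, Finset.mem_singleton] at hi hj
      omega
    · by_cases hn : n < d
      · simp only [U, hn, hm, if_true, if_false, Finset.mem_singleton] at hi hj
        have := hd _ j hj
        omega
      · simp only [U, hn, hm, if_false] at hi hj
        exact hb _ _ (by omega) i hi j hj
  refine ⟨⟨y, fun n => (hy n).2.1, rapidlyIncreasing_of_isBlock X.2.2 hU (fun n => (hy n).1)
    fun n => (hy n).length⟩, mem_basicVar.2 ⟨⟨U, hy, hU⟩, fun i hi => ?_⟩, fun i => ?_⟩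
  · simp [y, hi]
  · simp [y]

end BasicSets

/-! ### Amalgamation of basic sets -/

section Amalgamation

variable {α : Type*} {L : ℕ → Finset α} {X Y Z : VarWordSeq α}

theorem eval_append (x y : List (Option α)) (l : α) : eval (x ++ y) l = eval x l ++ eval y l :=
  List.map_append

theorem cat_map_add {β : Type*} (f : ℕ → List β) (k : ℕ) (s : Finset ℕ) :
    cat f (s.image (· + k)) = cat (fun n => f (n + k)) s := by
  induction s using Finset.induction_on_max with
  | empty => simp [cat_empty]
  | insert m s hm ih =>
    rw [Finset.image_insert, cat_insert, cat_insert _ hm, ih]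
    intro i hi
    obtain ⟨j, hj, rfl⟩ := Finset.mem_image.1 hi
    have := hm j hj
    omega

/-- A variable word is determined by two of its evaluations: one that agrees with evaluations of
`x` at two distinct letters is itself an evaluation of `x`. -/
theorem exists_evalVar_eq {x y : List (Option α)} (hx : none ∈ x) {l m : α} (hlm : l ≠ m)
    {p q : α} {F : Finset α} (hp : p ∈ F) (h1 : eval y l = eval x p) (h2 : eval y m = eval x q) :
    ∃ o ∈ Finset.insertNone F, y = evalVar x o := by
  have hlen : y.length = x.length := by
    rw [← length_eval y l, h1, length_eval]
  have e1 : ∀ i (hy : i < y.length) (hx : i < x.length), y[i].getD l = x[i].getD p := by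
    intro i hy hx
    have := List.getElem_of_eq h1 (i := i) (by rwa [length_eval])
    simpa [eval] using this
  have e2 : ∀ i (hy : i < y.length) (hx : i < x.length), y[i].getD m = x[i].getD q := by
    intro i hy hx
    have := List.getElem_of_eq h2 (i := i) (by rwa [length_eval])
    simpa [eval] using this
  obtain ⟨k, hk, hxk⟩ := List.mem_iff_getElem.1 hx
  have f1 := e1 k (by omega) hk
  have f2 := e2 k (by omega) hk
  rw [hxk] at f1 f2
  simp only [Option.getD_none] at f1 f2
  have key : ∀ o : Option α, o.getD l = p → o.getD m = q → y = evalVar x o := by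
    intro o ho1 ho2
    refine List.ext_getElem (by rw [length_evalVar, hlen]) fun i hi hi' => ?_
    rw [length_evalVar] at hi'
    have g1 := e1 i hi hi'
    have g2 := e2 i hi hi'
    simp only [evalVar, List.getElem_map]
    generalize y[i] = c at *
    generalize x[i] = e at *
    cases c <;> cases e <;> cases o <;> simp_all
  -- At a position `k` where `x` carries the variable, `y` shows what was substituted for it. If
  -- `y[k]` is a letter, that letter is `p`.
  refine ⟨y[k], ?_, key _ f1 f2⟩
  cases hc : y[k] with
  | none => simp
  | some c =>
    rw [hc] at f1
    simp only [Option.getD_some] at f1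
    simpa [f1] using hp

/-- Evaluation preserves lengths, so `y` can be cut at the total length of the earlier pieces, and
each segment is handled by `exists_evalVar_eq`. -/
theorem exists_cat_eq {l m : α} (hlm : l ≠ m) {p q : ℕ → α} (s : Finset ℕ)
    (hp : ∀ n ∈ s, p n ∈ L n) (y : List (Option α))
    (h1 : eval y l = cat (fun n => eval (X.1 n) (p n)) s)
    (h2 : eval y m = cat (fun n => eval (X.1 n) (q n)) s) :
    ∃ g : ℕ → List (Option α), (∀ n ∈ s, g n ∈ piecesVar L X n) ∧ y = cat g s := by
  induction s using Finset.induction_on_max generalizing y with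
  | empty =>
    rw [cat_empty, eval, List.map_eq_nil_iff] at h1
    exact ⟨fun _ => [], by simp, by rw [cat_empty, h1]⟩
  | insert k s hk ih =>
    rw [cat_insert _ hk] at h1 h2
    set c := ∑ n ∈ s, (X.1 n).length with hc
    have hl1 : (cat (fun n => eval (X.1 n) (p n)) s).length = c := by
      simp [length_cat, length_eval, hc]
    have hl2 : (cat (fun n => eval (X.1 n) (q n)) s).length = c := by
      simp [length_cat, length_eval, hc]
    have a1 := congrArg (List.take c) h1
    have a2 := congrArg (List.take c) h2
    have b1 := congrArg (List.drop c) h1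
    have b2 := congrArg (List.drop c) h2
    rw [List.take_left' hl1, eval, ← List.map_take] at a1
    rw [List.take_left' hl2, eval, ← List.map_take] at a2
    rw [List.drop_left' hl1, eval, ← List.map_drop] at b1
    rw [List.drop_left' hl2, eval, ← List.map_drop] at b2
    obtain ⟨g, hg, hy⟩ := ih (fun n hn => hp n (by simp [hn])) (y.take c) a1 a2
    obtain ⟨o, ho, hy'⟩ := exists_evalVar_eq (X.2.1 k) hlm (hp k (by simp)) b1 b2
    refine ⟨Function.update g k (y.drop c), fun n hn => ?_, ?_⟩
    · rcases Finset.mem_insert.1 hn with rfl | hn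
      · rw [Function.update_self]
        exact ⟨o, ho, hy'⟩
      · rw [Function.update_of_ne (hk n hn).ne]
        exact hg n hn
    · rw [cat_insert _ hk, Function.update_self]
      rw [cat_congr (g := g) fun n hn => Function.update_of_ne (hk n hn).ne _ _, ← hy,
        List.take_append_drop]

/-- Over a one-letter alphabet evaluations do not show where the variable stands, so `y` itself need
not lie in `[X]_{Lv}`. The concatenation of the `x_n`, `n ∈ s`, has the same evaluations and
replaces it. -/
theorem exists_isSuppVar_eval_eq {l m : α} (hlm : l ≠ m ∨ Subsingleton α)
    {y : List (Option α)} (hy : none ∈ y) {s : Finset ℕ} (h1 : IsSupp L X (eval y l) s)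
    (h2 : IsSupp L X (eval y m) s) :
    ∃ z, IsSuppVar L X z s ∧ ∀ k, eval z k = eval y k := by
  obtain ⟨hs, p, hp, h1⟩ := h1
  obtain ⟨-, q, -, h2⟩ := h2
  rcases hlm with hlm | hα
  · obtain ⟨g, hg, rfl⟩ := exists_cat_eq hlm s hp y h1 h2
    exact ⟨_, isSuppVar_iff.2 ⟨hy, hs, g, hg, rfl⟩, fun _ => rfl⟩
  · refine ⟨cat X.1 s, isSuppVar_iff.2 ⟨?_, hs, X.1, fun n _ =>
      ⟨none, by simp, (evalVar_none _).symm⟩, rfl⟩, fun k => ?_⟩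
    · obtain ⟨n, hn⟩ := hs
      exact mem_cat.2 ⟨n, hn, X.2.1 n⟩
    · rw [Subsingleton.elim k l, h1, eval, map_cat]
      exact cat_congr fun n _ => by rw [Subsingleton.elim (p n) l, eval]

theorem exists_two_letters (hmono : Monotone L) (hcover : ∀ l : α, ∃ n, l ∈ L n) (l₀ : α) :
    ∃ n, ∃ l ∈ L n, ∃ m ∈ L n, l ≠ m ∨ Subsingleton α := by
  by_cases h : Subsingleton α
  · obtain ⟨n, hn⟩ := hcover l₀
    exact ⟨n, l₀, hn, l₀, hn, .inr h⟩
  · rw [not_subsingleton_iff_nontrivial] at h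
    obtain ⟨l, m, hlm⟩ := h
    obtain ⟨i, hi⟩ := hcover l
    obtain ⟨j, hj⟩ := hcover m
    exact ⟨max i j, l, hmono (le_max_left _ _) hi, m, hmono (le_max_right _ _) hj, .inl hlm⟩

/-- Amalgamation: a basic set `[b, Z]` contained in `[b, X]` contains some `[b, Y]` with
`Y ∈ [depth_X b, X]`. -/
theorem exists_mem_basicVar_subset (hmono : Monotone L) (hcover : ∀ l : α, ∃ n, l ∈ L n)
    {b : List (List α)} (hZ : (basic L b Z).Nonempty) (hZX : basic L b Z ⊆ basic L b X) :
    ∃ Y ∈ basicVar L (depth L X b) X, basic L b Y ⊆ basic L b Z := by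
  have hX : (basic L b X).Nonempty := hZ.mono hZX
  obtain ⟨-, l₀, -⟩ := exists_letter hZ
  obtain ⟨n₀, l, hl, m, hm, hlm⟩ := exists_two_letters hmono hcover l₀
  set d := depth L X b with hd
  set N := max (max d (depth L Z b)) n₀ with hN
  have hNd : d ≤ N := by omega
  -- No relation `Z ≤ X` is available, only the inclusion of basic sets. It is tested on the
  -- sequence that continues `b` by the tail of `Z` evaluated at a constant letter.
  have key : ∀ k ∈ L n₀, ∃ S : ℕ → Finset ℕ, (∀ i, IsSupp L X (eval (Z.1 (N + i)) k) (S i)) ∧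
      (∀ i, ∀ j ∈ S i, d ≤ j) ∧ IsBlock S := by
    intro k hk
    obtain ⟨A, hA, hAk⟩ := exists_mem_basic (finLE₀_depth hZ)
      (w := fun i => eval (Z.1 (N + i)) k)
      (S := fun i => {N + i}) (fun i => (isSuppVar_self Z _).eval fun m hm => by
        rw [Finset.mem_singleton] at hm
        exact hmono (by omega) hk) (fun i j hj => by rw [Finset.mem_singleton] at hj; omega)
      (fun n m hnm i hi j hj => by rw [Finset.mem_singleton] at hi hj; omega)
    obtain ⟨S, hS, hS'⟩ := exists_tail_supports (hZX hA)
    exact ⟨S, fun i => by rw [← hAk]; exact hS i, hS'⟩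
  obtain ⟨S, hS, hSd, hSb⟩ := key l hl
  obtain ⟨S', hS', -, -⟩ := key m hm
  -- The two evaluations have equal length, and lengths determine supports because `X` is rapidly
  -- increasing.
  have hSS : ∀ i, S i = S' i := fun i => X.2.2.finset_eq' <| by
    rw [← (hS i).length, ← (hS' i).length, length_eval, length_eval]
  choose z hz hzZ using fun i => exists_isSuppVar_eval_eq hlm (Z.2.1 (N + i)) (hS i)
    (by rw [hSS]; exact hS' i)
  obtain ⟨Y, hY, hYz⟩ := exists_mem_basicVar d hz hSd hSb
  refine ⟨Y, hY, fun A hA => ?_⟩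
  obtain ⟨T, hT, hTd, hTb⟩ := exists_tail_supports hA
  rw [(basic_nonempty_of_mem hmono hX hY).2, ← hd] at hTd
  -- For `n ≥ d`, the term `n` of `Y` has the evaluations of the term `n + (N - d)` of `Z`, so
  -- supports are translated by `N - d`. The letters remain admissible since `L` is increasing.
  refine mem_basic_of_tail (finLE₀_depth hZ) (mem_basic.1 hA).2
    (S := fun i => (T i).image (· + (N - d))) (fun i => ?_) (fun i j hj => ?_) ?_
  · obtain ⟨hne, p, hp, hA⟩ := hT i
    refine isSupp_iff.2 ⟨hne.image _, fun n => eval (Z.1 n) (p (n - (N - d))), fun n hn => ?_, ?_⟩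
    · obtain ⟨j, hj, rfl⟩ := Finset.mem_image.1 hn
      refine ⟨_, ?_, rfl⟩
      rw [Nat.add_sub_cancel]
      exact hmono (Nat.le_add_right _ _) (hp j hj)
    · rw [cat_map_add, hA]
      refine cat_congr fun n hn => ?_
      have h1 := hTd i n hn
      have h2 := hYz (n - d)
      rw [show d + (n - d) = n by omega] at h2
      simp only [h2, hzZ, Nat.add_sub_cancel]
      rw [show N + (n - d) = n + (N - d) by omega]
  · obtain ⟨k, hk, rfl⟩ := Finset.mem_image.1 hj
    have := hTd i k hk
    omega
  · intro n m hnm i hi j hj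
    obtain ⟨i', hi', rfl⟩ := Finset.mem_image.1 hi
    obtain ⟨j', hj', rfl⟩ := Finset.mem_image.1 hj
    exact Nat.add_lt_add_right (hTb n m hnm i' hi' j' hj') _

end Amalgamation

/-! ### Finitely many finite sequences of bounded depth -/

section Finiteness

variable {α : Type*} {L : ℕ → Finset α} {X : VarWordSeq α}

theorem finite_setOf_isSupp (N : ℕ) :
    {w | ∃ s ⊆ Finset.range N, IsSupp L X w s}.Finite := by
  have : {w | ∃ s ⊆ Finset.range N, ∃ l : ℕ → α, (∀ n ∈ s, l n ∈ L n) ∧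
      w = cat (fun n => eval (X.1 n) (l n)) s}.Finite := by
    induction N with
    | zero =>
      refine (Set.finite_singleton []).subset ?_
      rintro w ⟨s, hs, l, -, rfl⟩
      rw [Finset.range_zero, Finset.subset_empty] at hs
      rw [hs, cat_empty]
      rfl
    | succ N ih =>
      refine (ih.union (ih.image2 (fun w l => w ++ eval (X.1 N) l)
        (L N).finite_toSet)).subset ?_
      rintro w ⟨s, hs, l, hl, rfl⟩
      have hlt : ∀ i ∈ s.erase N, i < N := fun i hi => by
        have := Finset.mem_range.1 (hs (Finset.mem_of_mem_erase hi))
        have := Finset.ne_of_mem_erase hi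
        omega
      have hle : s.erase N ⊆ Finset.range N := fun i hi => Finset.mem_range.2 (hlt i hi)
      by_cases hN : N ∈ s
      · refine .inr ⟨_, ⟨s.erase N, hle, l, fun n hn => hl n (Finset.mem_of_mem_erase hn), rfl⟩,
          l N, hl N hN, ?_⟩
        conv_rhs => rw [← Finset.insert_erase hN]
        rw [cat_insert _ hlt]
      · rw [Finset.erase_eq_of_notMem hN] at hle
        exact .inl ⟨s, hle, l, hl, rfl⟩
  exact this.subset fun w ⟨s, hs, _, l, hl, hw⟩ => ⟨s, hs, l, hl, hw⟩

theorem FinLE₀.length_le {a : List (List α)} {N : ℕ} (h : FinLE₀ L a X N) : a.length ≤ N := by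
  obtain ⟨S, hS, hb⟩ := h
  have key : ∀ n < a.length, ∀ i ∈ S n, n ≤ i := by
    intro n
    induction n with
    | zero => simp
    | succ n ih =>
      intro hn i hi
      obtain ⟨j, hj⟩ := (hS n (by omega)).1.1
      have := hb n (n + 1) (by omega) hn j hj i hi
      have := ih (by omega) j hj
      omega
  rcases Nat.eq_zero_or_pos a.length with h0 | h0
  · omega
  · have hn : a.length - 1 < a.length := by omega
    obtain ⟨i, hi⟩ := (hS _ hn).1.1
    have := key _ hn i hi
    have := Finset.mem_range.1 ((hS _ hn).2 hi)
    omega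

theorem finite_setOf_finLE₀ (N : ℕ) : {a : List (List α) | FinLE₀ L a X N}.Finite := by
  have hW := finite_setOf_isSupp (L := L) (X := X) N
  set W := {w | ∃ s ⊆ Finset.range N, IsSupp L X w s}
  have : Finite W := hW
  refine ((List.finite_length_le W N).image (List.map Subtype.val)).subset ?_
  intro a ha
  obtain ⟨S, hS, -⟩ := id ha
  have haW : ∀ w ∈ a, w ∈ W := by
    intro w hw
    obtain ⟨n, hn, rfl⟩ := List.mem_iff_getElem.1 hw
    exact ⟨S n, (hS n hn).2, (hS n hn).1⟩
  lift a to List W using haW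
  exact ⟨a, by simpa using FinLE₀.length_le ha, rfl⟩

end Finiteness

/-! ### Idempotent ultrafilters of words and variable words -/

section Ultrafilters

open Filter

attribute [local instance] Ultrafilter.semigroup

theorem ultrafilter_map_mul {M N : Type*} [Semigroup M] [Semigroup N] (f : M → N)
    (hf : ∀ x y, f (x * y) = f x * f y) (U V : Ultrafilter M) :
    (U * V).map f = U.map f * V.map f := by
  refine Ultrafilter.coe_inj.1 (Filter.ext' fun p => ?_)
  simp only [Ultrafilter.eventually_mul, Ultrafilter.coe_map, eventually_map, hf]

/-- A compact right topological semigroup contains a minimal closed left ideal. -/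
theorem exists_minimal_leftIdeal {M : Type*} [Semigroup M] [TopologicalSpace M] [CompactSpace M]
    [T2Space M] {D : Set M} (hD : IsClosed D) (hne : D.Nonempty)
    (hmul : ∀ x ∈ D, ∀ y ∈ D, x * y ∈ D) :
    ∃ J ⊆ D, IsClosed J ∧ J.Nonempty ∧ (∀ x ∈ D, ∀ y ∈ J, x * y ∈ J) ∧
      ∀ K ⊆ J, IsClosed K → K.Nonempty → (∀ x ∈ D, ∀ y ∈ K, x * y ∈ K) → K = J := by
  let 𝓢 : Set (Set M) := {J | J ⊆ D ∧ IsClosed J ∧ J.Nonempty ∧ ∀ x ∈ D, ∀ y ∈ J, x * y ∈ J}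
  obtain ⟨J, hJ⟩ : ∃ J, Minimal (· ∈ 𝓢) J := by
    refine zorn_superset 𝓢 fun c hcs hc => ?_
    rcases c.eq_empty_or_nonempty with rfl | hcne
    · exact ⟨D, ⟨subset_rfl, hD, hne, hmul⟩, by simp⟩
    refine ⟨⋂₀ c, ⟨?_, isClosed_sInter fun K hK => (hcs hK).2.1, ?_, ?_⟩,
      fun K hK => Set.sInter_subset_of_mem hK⟩
    · obtain ⟨K, hK⟩ := hcne
      exact (Set.sInter_subset_of_mem hK).trans (hcs hK).1
    · have := hcne.coe_sort
      rw [Set.sInter_eq_iInter]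
      refine IsCompact.nonempty_iInter_of_directed_nonempty_isCompact_isClosed _
        (DirectedOn.directed_val (IsChain.directedOn hc.symm)) (fun K => (hcs K.2).2.2.1)
        (fun K => (hcs K.2).2.1.isCompact) fun K => (hcs K.2).2.1
    · intro x hx y hy K hK
      exact (hcs hK).2.2.2 x hx y (hy K hK)
  refine ⟨J, hJ.1.1, hJ.1.2.1, hJ.1.2.2.1, hJ.1.2.2.2, fun K hKJ hK hKne hKm => ?_⟩
  exact Set.Subset.antisymm hKJ (hJ.2 ⟨hKJ.trans hJ.1.1, hK, hKne, hKm⟩ hKJ)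

/-- The closed left ideal `D * e` is contained in `J`, hence equals `J` and contains `u`. Writing `u
= z * e` gives `u * e = z * e * e = u`, while `u * e = e` by hypothesis. -/
theorem eq_of_idempotent_of_minimal {M : Type*} [Semigroup M] [TopologicalSpace M]
    [CompactSpace M] [T2Space M] (hc : ∀ r : M, Continuous (· * r)) {D J : Set M}
    (hD : IsClosed D) (hJD : J ⊆ D) (hmul : ∀ x ∈ D, ∀ y ∈ D, x * y ∈ D)
    (hJ : ∀ x ∈ D, ∀ y ∈ J, x * y ∈ J)
    (hmin : ∀ K ⊆ J, IsClosed K → K.Nonempty → (∀ x ∈ D, ∀ y ∈ K, x * y ∈ K) → K = J)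
    {u e : M} (hu : u ∈ J) (he : e ∈ J) (hee : e * e = e) (hue : u * e = e) : e = u := by
  have hK : (· * e) '' D = J := by
    refine hmin _ ?_ ?_ ⟨e * e, e, hJD he, rfl⟩ ?_
    · rintro _ ⟨x, hx, rfl⟩
      exact hJ x hx e he
    · exact (hD.isCompact.image (hc e)).isClosed
    · rintro x hx _ ⟨y, hy, rfl⟩
      exact ⟨x * y, hmul x hx y hy, mul_assoc x y e⟩
  rw [← hK] at hu
  obtain ⟨z, -, hz⟩ := hu
  simp only at hz
  rw [← hz, mul_assoc, hee, hz] at hue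
  exact hue.symm

variable {α : Type*} {L : ℕ → Finset α}

theorem eval_map_some (w : List α) (l : α) : eval (w.map some) l = w := by
  rw [eval, List.map_map]
  exact List.map_id _

/-- Variable words of `[X]_{Lv}` with support in `{m, m + 1, …}`. -/
def TailVarWord (L : ℕ → Finset α) (X : VarWordSeq α) (m : ℕ) (x : List (Option α)) : Prop :=
  ∃ s, IsSuppVar L X x s ∧ ∀ j ∈ s, m ≤ j

theorem IsSupp.comb_map_some {X : VarWordSeq α} {w : List α} {s : Finset ℕ}
    (h : IsSupp L X w s) : Comb (piecesVar L X) (w.map some) s := by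
  refine (isSupp_iff.1 h).map some ?_
  rintro n - _ ⟨l, hl, rfl⟩
  refine ⟨some l, by simpa using hl, ?_⟩
  rw [eval, evalVar, List.map_map]
  refine List.map_congr_left fun c _ => ?_
  cases c <;> rfl

theorem TailWord.exists_append {X : VarWordSeq α} {m : ℕ} {w : List α} (hw : TailWord L X m w) :
    ∃ k, (∀ w', TailWord L X k w' → TailWord L X m (w ++ w')) ∧
      ∀ x, TailVarWord L X k x → TailVarWord L X m (w.map some ++ x) := by
  obtain ⟨s, hs, hm⟩ := hw
  have hlt : ∀ t : Finset ℕ, (∀ j ∈ t, max m (s.sup id + 1) ≤ j) → ∀ i ∈ s, ∀ j ∈ t, i < j := by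
    intro t ht i hi j hj
    have h1 := Finset.le_sup (f := id) hi
    have h2 := ht j hj
    simp only [id] at h1
    omega
  have hle : ∀ t : Finset ℕ, (∀ j ∈ t, max m (s.sup id + 1) ≤ j) → ∀ j ∈ s ∪ t, m ≤ j := by
    intro t ht j hj
    rcases Finset.mem_union.1 hj with hj | hj
    · exact hm j hj
    · have := ht j hj
      omega
  refine ⟨max m (s.sup id + 1), ?_, ?_⟩
  · rintro w' ⟨t, ht, htm⟩
    exact ⟨s ∪ t, isSupp_iff.2 ((isSupp_iff.1 hs).append (isSupp_iff.1 ht) (hlt t htm)),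
      hle t htm⟩
  · rintro x ⟨t, ht, htm⟩
    obtain ⟨h1, h2⟩ := isSuppVar_iff.1 ht
    exact ⟨s ∪ t, isSuppVar_iff.2 ⟨List.mem_append_right _ h1,
      (IsSupp.comb_map_some hs).append h2 (hlt t htm)⟩, hle t htm⟩

theorem TailVarWord.exists_append {X : VarWordSeq α} {m : ℕ} {x : List (Option α)}
    (hx : TailVarWord L X m x) :
    ∃ k, (∀ w, TailWord L X k w → TailVarWord L X m (x ++ w.map some)) ∧
      ∀ y, TailVarWord L X k y → TailVarWord L X m (x ++ y) := by
  obtain ⟨s, hs, hm⟩ := hx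
  obtain ⟨h1, h2⟩ := isSuppVar_iff.1 hs
  have key : ∀ (y : List (Option α)) (t : Finset ℕ), Comb (piecesVar L X) y t →
      (∀ j ∈ t, max m (s.sup id + 1) ≤ j) → TailVarWord L X m (x ++ y) := by
    intro y t hy ht
    refine ⟨s ∪ t, isSuppVar_iff.2 ⟨List.mem_append_left _ h1, h2.append hy ?_⟩, ?_⟩
    · intro i hi j hj
      have h1 := Finset.le_sup (f := id) hi
      have h2 := ht j hj
      simp only [id] at h1
      omega
    · intro j hj
      rcases Finset.mem_union.1 hj with hj | hj
      · exact hm j hj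
      · have := ht j hj
        omega
  refine ⟨max m (s.sup id + 1), ?_, ?_⟩
  · rintro w ⟨t, ht, htm⟩
    exact key _ t (IsSupp.comb_map_some ht) htm
  · rintro y ⟨t, ht, htm⟩
    exact key _ t (isSuppVar_iff.1 ht).2 htm

theorem TailVarWord.eval {X : VarWordSeq α} {m : ℕ} {x : List (Option α)}
    (hmono : Monotone L) {l : α} (hl : l ∈ L m) (hx : TailVarWord L X m x) :
    TailWord L X m (eval x l) := by
  obtain ⟨s, hs, hm⟩ := hx
  exact ⟨s, hs.eval fun n hn => hmono (hm n hn) hl, hm⟩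

theorem TailWord.anti {X : VarWordSeq α} {m k : ℕ} (hmk : m ≤ k) {w : List α}
    (hw : TailWord L X k w) : TailWord L X m w := by
  obtain ⟨s, hs, h⟩ := hw
  exact ⟨s, hs, fun j hj => hmk.trans (h j hj)⟩

/-- The ultrafilters behind the infinite Hales–Jewett theorem: an idempotent ultrafilter of words
that is the image, under every evaluation, of one and the same ultrafilter of variable words. -/
theorem exists_ultrafilter (hmono : Monotone L) (hcover : ∀ l : α, ∃ n, l ∈ L n) (l₀ : α)
    (X : VarWordSeq α) :
    ∃ (u : Ultrafilter (List α)) (v : Ultrafilter (List (Option α))),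
      (∀ p : List α → Prop, (∀ᶠ w in u, p w) ↔ ∀ᶠ w in u, ∀ᶠ w' in u, p (w ++ w')) ∧
      (∀ m, ∀ᶠ w in u, TailWord L X m w) ∧ (∀ m, ∀ᶠ x in v, TailVarWord L X m x) ∧
      ∀ (l : α) (p : List α → Prop), (∀ᶠ w in u, p w) ↔ ∀ᶠ x in v, p (eval x l) := by
  let D : Set (Ultrafilter (FreeMonoid α)) :=
    {U | ∀ m, ∀ᶠ w in (U : Filter (FreeMonoid α)), TailWord L X m (FreeMonoid.toList w)}
  let E : Set (Ultrafilter (FreeMonoid (Option α))) :=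
    {V | ∀ m, ∀ᶠ x in (V : Filter (FreeMonoid (Option α))),
      TailVarWord L X m (FreeMonoid.toList x)}
  have hDc : IsClosed D := by
    simp only [D, Set.ofPred_forall]
    exact isClosed_iInter fun m => ultrafilter_isClosed_basic _
  have hEc : IsClosed E := by
    simp only [E, Set.ofPred_forall]
    exact isClosed_iInter fun m => ultrafilter_isClosed_basic _
  let T (l : α) : FreeMonoid (Option α) → FreeMonoid α :=
    fun x => FreeMonoid.ofList (eval (FreeMonoid.toList x) l)
  have hT : ∀ l x y, T l (x * y) = T l x * T l y := fun l x y => eval_append _ _ _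
  let ι : FreeMonoid α → FreeMonoid (Option α) :=
    fun w => FreeMonoid.ofList ((FreeMonoid.toList w).map some)
  have hι : ∀ x y, ι (x * y) = ι x * ι y := fun x y => List.map_append
  have hTι : ∀ l, T l ∘ ι = id := by
    intro l
    funext w
    exact eval_map_some _ l
  have hDne : D.Nonempty := by
    obtain ⟨n, hn⟩ := hcover l₀
    refine ⟨(hyperfilter ℕ).map fun i => FreeMonoid.ofList (eval (X.1 i) l₀), fun m => ?_⟩
    rw [Ultrafilter.coe_map, eventually_map]
    refine Filter.Eventually.filter_mono (Nat.hyperfilter_le_atTop) ?_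
    filter_upwards [eventually_ge_atTop (max m n)] with i hi
    refine ⟨{i}, (isSuppVar_self X i).eval fun k hk => ?_, fun j hj => ?_⟩
    · rw [Finset.mem_singleton] at hk
      exact hmono (by omega) hn
    · rw [Finset.mem_singleton] at hj
      omega
  have hEne : E.Nonempty := by
    refine ⟨(hyperfilter ℕ).map fun i => FreeMonoid.ofList (X.1 i), fun m => ?_⟩
    rw [Ultrafilter.coe_map, eventually_map]
    refine Filter.Eventually.filter_mono (Nat.hyperfilter_le_atTop) ?_
    filter_upwards [eventually_ge_atTop m] with i hi
    exact ⟨{i}, isSuppVar_self X i, fun j hj => by rw [Finset.mem_singleton] at hj; omega⟩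
  have hDD : ∀ x ∈ D, ∀ y ∈ D, x * y ∈ D := by
    intro U hU V hV m
    rw [Ultrafilter.eventually_mul]
    -- The product first chooses `w` by `U` and then `w'` by `V`. Thus `w'` may be taken beyond the
    -- support of `w`.
    filter_upwards [hU m] with w hw
    obtain ⟨k, hk, -⟩ := hw.exists_append
    filter_upwards [hV k] with w' hw'
    exact hk _ hw'
  have hEE : ∀ x ∈ E, ∀ y ∈ E, x * y ∈ E := by
    intro U hU V hV m
    rw [Ultrafilter.eventually_mul]
    filter_upwards [hU m] with w hw
    obtain ⟨k, -, hk⟩ := hw.exists_append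
    filter_upwards [hV k] with w' hw'
    exact hk _ hw'
  have hDE : ∀ x ∈ D, ∀ y ∈ E, x.map ι * y ∈ E := by
    intro U hU V hV m
    rw [Ultrafilter.eventually_mul, Ultrafilter.coe_map, eventually_map]
    filter_upwards [hU m] with w hw
    obtain ⟨k, -, hk⟩ := hw.exists_append
    filter_upwards [hV k] with w' hw'
    exact hk _ hw'
  have hED : ∀ x ∈ E, ∀ y ∈ D, x * y.map ι ∈ E := by
    intro U hU V hV m
    rw [Ultrafilter.eventually_mul]
    simp only [Ultrafilter.coe_map, eventually_map]
    filter_upwards [hU m] with w hw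
    obtain ⟨k, hk, -⟩ := hw.exists_append
    filter_upwards [hV k] with w' hw'
    exact hk _ hw'
  have hTE : ∀ l, ∀ x ∈ E, x.map (T l) ∈ D := by
    intro l V hV m
    rw [Ultrafilter.coe_map, eventually_map]
    obtain ⟨n, hn⟩ := hcover l
    filter_upwards [hV (max m n)] with x hx
    exact (hx.eval hmono (hmono (le_max_right _ _) hn)).anti (le_max_left _ _)
  obtain ⟨J, hJD, hJc, hJne, hDJ, hmin⟩ := exists_minimal_leftIdeal hDc hDne hDD
  obtain ⟨u, huJ, huu⟩ := exists_idempotent_in_compact_subsemigroup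
    (fun r => Ultrafilter.continuous_mul_left r) J hJne hJc.isCompact
    fun x hx y hy => hDJ x (hJD hx) y hy
  have huD := hJD huJ
  have hιu : u.map ι * u.map ι = u.map ι := by rw [← ultrafilter_map_mul ι hι, huu]
  have hTu : ∀ l, (u.map ι).map (T l) = u := fun l => by
    rw [Ultrafilter.map_map, hTι, Ultrafilter.map_id]
  -- Looking for `w` in `E * ι(u)` ensures `w * ι(u) = w` and puts every evaluation of `w` into the
  -- left ideal `J`.
  obtain ⟨w, ⟨y, hy, hyw⟩, hww⟩ := exists_idempotent_in_compact_subsemigroup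
    (fun r => Ultrafilter.continuous_mul_left r) ((· * u.map ι) '' E) (hEne.image _)
    (hEc.isCompact.image (Ultrafilter.continuous_mul_left _)) (by
      rintro _ ⟨x, hx, rfl⟩ _ ⟨y, hy, rfl⟩
      exact ⟨x * u.map ι * y, hEE _ (hED x hx u huD) _ hy, mul_assoc _ _ _⟩)
  simp only at hyw
  have hwE : w ∈ E := hyw ▸ hED y hy u huD
  have hwu : w * u.map ι = w := by rw [← hyw, mul_assoc, hιu]
  have hTw : ∀ l, w.map (T l) ∈ J := fun l => by
    rw [← hyw, ultrafilter_map_mul _ (hT l), hTu]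
    exact hDJ _ (hTE l y hy) u huJ
  have hTwu : ∀ l, w.map (T l) * u = w.map (T l) := fun l => by
    conv_lhs => rw [← hTu l, ← ultrafilter_map_mul _ (hT l), hwu]
  -- The image of `ι(u) * w` under `T l` is `u * T l(w)`. It is an idempotent of `J` fixed by left
  -- multiplication by `u`, so minimality forces it to be `u`, for all letters `l` at once.
  have hv : ∀ l, (u.map ι * w).map (T l) = u := by
    intro l
    have h1 : (u.map ι * w).map (T l) = u * w.map (T l) := by
      rw [ultrafilter_map_mul _ (hT l), hTu]
    rw [h1]
    refine eq_of_idempotent_of_minimal (fun r => Ultrafilter.continuous_mul_left r) hDc hJD hDD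
      hDJ hmin huJ (hDJ u huD _ (hTw l)) ?_ ?_
    · rw [mul_assoc, ← mul_assoc (w.map (T l)), hTwu, ← ultrafilter_map_mul _ (hT l), hww]
    · rw [← mul_assoc, huu]
  refine ⟨u, u.map ι * w, fun p => ?_, huD, hDE u huD w hwE, fun l p => ?_⟩
  · conv_lhs => rw [← huu]
    rfl
  · conv_lhs => rw [← hv l]
    rfl

end Ultrafilters

/-! ### Cantor schemes and perfect sets -/

section PerfectSets

/-- The basic clopen set of all points of the Cantor space that begin with `l`. -/
def cyl (l : List Bool) : Set (ℕ → Bool) :=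
  {x | ∀ i (h : i < l.length), x i = l[i]}

theorem isClopen_cyl (l : List Bool) : IsClopen (cyl l) := by
  have : cyl l = ⋂ i : Fin l.length, (fun x : ℕ → Bool => x i) ⁻¹' {l[i]} := by
    ext x
    simp only [cyl, Set.mem_iInter]
    exact ⟨fun h i => h i i.2, fun h i hi => h ⟨i, hi⟩⟩
  rw [this]
  exact isClopen_iInter_of_finite fun i =>
    (isClopen_discrete _).preimage (continuous_apply _)

theorem mem_cyl_initSeg {x y : ℕ → Bool} {n : ℕ} :
    y ∈ cyl (initSeg x n) ↔ ∀ i < n, y i = x i := by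
  simp [cyl, initSeg]

theorem countable_setOf_cyl (D : Set (ℕ → Bool)) :
    {x ∈ D | ∃ n, (D ∩ cyl (initSeg x n)).Countable}.Countable := by
  refine Set.Countable.mono (s₂ := ⋃ l ∈ {l | (D ∩ cyl l).Countable}, D ∩ cyl l) ?_
    (Set.Countable.biUnion (Set.to_countable _) fun l hl => hl)
  rintro x ⟨hx, n, hn⟩
  exact Set.mem_biUnion (x := initSeg x n) hn ⟨hx, mem_cyl_initSeg.2 fun _ _ => rfl⟩

/-- An uncountable set is split into two uncountable parts by small disjoint clopen sets. -/
theorem exists_split {D : Set (ℕ → Bool)} (hD : ¬ D.Countable) (n : ℕ) :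
    ∃ U : Bool → Set (ℕ → Bool), (∀ b, IsClosed (U b)) ∧ (∀ b, ¬ (D ∩ U b).Countable) ∧
      Disjoint (U false) (U true) ∧ ∀ b, ∀ x ∈ U b, ∀ y ∈ U b, ∀ i < n, x i = y i := by
  -- Discarding the countably many points with a countable neighbourhood leaves only condensation
  -- points; any two of them are separated by cylinders meeting `D` uncountably.
  set D' := D \ {x ∈ D | ∃ n, (D ∩ cyl (initSeg x n)).Countable} with hD'
  have hD'u : ¬ D'.Countable := fun h => hD <| by
    refine (h.union (countable_setOf_cyl D)).mono fun x hx => ?_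
    by_cases hx' : x ∈ {x ∈ D | ∃ n, (D ∩ cyl (initSeg x n)).Countable}
    · exact .inr hx'
    · exact .inl ⟨hx, hx'⟩
  have hnt : D'.Nontrivial := by
    by_contra h
    rw [Set.not_nontrivial_iff] at h
    exact hD'u h.countable
  obtain ⟨x, hx, y, hy, hxy⟩ := hnt
  obtain ⟨k, hk⟩ := Function.ne_iff.1 hxy
  have hunc : ∀ z ∈ D', ∀ m, ¬ (D ∩ cyl (initSeg z m)).Countable := fun z hz m hc =>
    hz.2 ⟨hz.1, m, hc⟩
  refine ⟨fun b => cyl (initSeg (cond b x y) (max n (k + 1))), fun b => (isClopen_cyl _).1,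
    fun b => ?_, ?_, fun b z hz w hw i hi => ?_⟩
  · cases b
    · exact hunc y hy _
    · exact hunc x hx _
  · refine Set.disjoint_left.2 fun z hz hz' => hk ?_
    rw [mem_cyl_initSeg] at hz hz'
    exact (hz' k (by omega)).symm.trans (hz k (by omega))
  · rw [mem_cyl_initSeg] at hz hw
    rw [hz i (by omega), hw i (by omega)]

theorem not_countable_of_mem_perfectSets {M : Set (ℕ → Bool)} (hM : M ∈ perfectSets) :
    ¬ M.Countable := by
  let := TopologicalSpace.upgradeIsCompletelyMetrizable (ℕ → Bool)
  obtain ⟨f, hf, -, hinj⟩ := hM.1.exists_nat_bool_injection hM.2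
  intro h
  have h1 : (Set.univ : Set (ℕ → Bool)).Countable :=
    Set.MapsTo.countable_of_injOn (fun x _ => hf ⟨x, rfl⟩) hinj.injOn h
  have h2 := Cardinal.mk_le_aleph0_iff.2 (Set.countable_univ_iff.1 h1)
  have h3 := Cardinal.cantor Cardinal.aleph0
  simp at h2
  exact absurd h2 (not_le.2 h3)

theorem exists_perfect_subset {M : Set (ℕ → Bool)} (hM : IsClosed M) (hu : ¬ M.Countable) :
    ∃ N ∈ perfectSets, N ⊆ M := by
  obtain ⟨N, h1, h2, h3⟩ := exists_perfect_nonempty_of_isClosed_of_not_countable hM hu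
  exact ⟨N, ⟨h1, h2⟩, h3⟩

/-- Some piece meets the uncountable set `M` in an uncountable closed set, which has a perfect
kernel. This is what makes properties known only locally on `M` usable. -/
theorem exists_perfect_subset_of_cover {M : Set (ℕ → Bool)} (hM : M ∈ perfectSets)
    {F : Set (Set (ℕ → Bool))} (hF : F.Finite) (hcl : ∀ N ∈ F, IsClosed N) (hMF : M ⊆ ⋃₀ F) :
    ∃ N ∈ F, ∃ M' ∈ perfectSets, M' ⊆ M ∧ M' ⊆ N := by
  by_contra hcon
  refine not_countable_of_mem_perfectSets hM ?_
  refine Set.Countable.mono (s₂ := ⋃ N ∈ F, M ∩ N) (fun x hx => ?_)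
    (hF.countable.biUnion fun N hN => ?_)
  · obtain ⟨N, hN, hxN⟩ := hMF hx
    exact Set.mem_biUnion hN ⟨hx, hxN⟩
  · by_contra hu
    obtain ⟨M', h1, h2⟩ := exists_perfect_subset (hM.1.closed.inter (hcl N hN)) hu
    exact hcon ⟨N, hN, M', h1, h2.trans Set.inter_subset_left, h2.trans Set.inter_subset_right⟩

/-- The limit of a Cantor scheme. -/
def schemeLimit (A : List Bool → Set (ℕ → Bool)) : Set (ℕ → Bool) :=
  ⋂ n, ⋃ l ∈ {l : List Bool | l.length = n}, A l

theorem schemeLimit_subset (A : List Bool → Set (ℕ → Bool)) (n : ℕ) :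
    schemeLimit A ⊆ ⋃ l ∈ {l : List Bool | l.length = n}, A l :=
  Set.iInter_subset _ n

theorem scheme_append {A : List Bool → Set (ℕ → Bool)} (hA : ∀ b l, A (b :: l) ⊆ A l)
    (s l : List Bool) : A (s ++ l) ⊆ A l := by
  induction s with
  | nil => exact subset_rfl
  | cons b s ih => exact (hA b _).trans ih

theorem scheme_inter_nonempty {A : List Bool → Set (ℕ → Bool)} (hcl : ∀ l, IsClosed (A l))
    (hne : ∀ l, (A l).Nonempty) (hA : ∀ b l, A (b :: l) ⊆ A l) (l : List Bool) :
    (A l ∩ schemeLimit A).Nonempty := by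
  obtain ⟨x, hx⟩ := IsCompact.nonempty_iInter_of_sequence_nonempty_isCompact_isClosed
    (fun k => A (List.replicate k false ++ l)) (fun k => hA _ _) (fun k => hne _)
    (hcl _).isCompact fun k => hcl _
  rw [Set.mem_iInter] at hx
  have hxl : x ∈ A l := hx 0
  refine ⟨x, hxl, Set.mem_iInter.2 fun n => ?_⟩
  rcases le_total l.length n with h | h
  · refine Set.mem_biUnion (x := List.replicate (n - l.length) false ++ l) ?_ (hx _)
    simp [h]
  · refine Set.mem_biUnion (x := l.drop (l.length - n)) ?_
      (scheme_append hA (l.take (l.length - n)) _ (by rwa [List.take_append_drop]))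
    simp only [Set.mem_ofPred_eq, List.length_drop]
    omega

/-- New bits are added at the head, so the children of `l` are `false :: l` and `true :: l`. A small
node containing `x` has two disjoint children, both meeting the limit, and one of them supplies a
point other than `x`. -/
theorem schemeLimit_mem_perfectSets {A : List Bool → Set (ℕ → Bool)}
    (hcl : ∀ l, IsClosed (A l)) (hne : ∀ l, (A l).Nonempty) (hA : ∀ b l, A (b :: l) ⊆ A l)
    (hdisj : ∀ l, Disjoint (A (false :: l)) (A (true :: l)))
    (hsmall : ∀ b l, ∀ x ∈ A (b :: l), ∀ y ∈ A (b :: l), ∀ i < l.length, x i = y i) :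
    schemeLimit A ∈ perfectSets := by
  refine ⟨⟨isClosed_iInter fun n => (List.finite_length_eq Bool n).isClosed_biUnion
    fun l _ => hcl l, fun x hx => ?_⟩,
    (scheme_inter_nonempty hcl hne hA []).mono Set.inter_subset_right⟩
  rw [accPt_iff_nhds]
  intro U hU
  obtain ⟨_, ⟨z, n, rfl⟩, hxz, hzU⟩ :=
    (PiNat.isTopologicalBasis_cylinders (fun _ => Bool)).mem_nhds_iff.1 hU
  have hx' := schemeLimit_subset A (n + 1) hx
  obtain ⟨l, hl, hxl⟩ := Set.mem_iUnion₂.1 hx'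
  obtain ⟨b, t, rfl⟩ : ∃ b t, l = b :: t := List.exists_cons_of_length_eq_add_one hl
  have ht : t.length = n := by simpa using hl
  obtain ⟨y₀, hy₀, hy₀M⟩ := scheme_inter_nonempty hcl hne hA (false :: b :: t)
  obtain ⟨y₁, hy₁, hy₁M⟩ := scheme_inter_nonempty hcl hne hA (true :: b :: t)
  have hU' : ∀ y ∈ A (b :: t), y ∈ U := fun y hy => hzU fun i hi => by
    rw [hsmall b t y hy x hxl i (by omega)]
    exact hxz i hi
  by_cases h : y₀ = x
  · refine ⟨y₁, ⟨hU' y₁ (hA _ _ hy₁), hy₁M⟩, ?_⟩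
    rintro rfl
    exact Set.disjoint_left.1 (hdisj _) (h ▸ hy₀) hy₁
  · exact ⟨y₀, ⟨hU' y₀ (hA _ _ hy₀), hy₀M⟩, h⟩

end PerfectSets

/-- Dependent choice with an invariant `I` and a relation `R` between successive states; it runs the
constructions of both the pigeonhole principle and the fusion. -/
theorem exists_seq_of_step {σ : Type*} (I : ℕ → σ → Prop) (R : ℕ → σ → σ → Prop) {s₀ : σ}
    (h₀ : I 0 s₀) (step : ∀ n s, I n s → ∃ s', I (n + 1) s' ∧ R n s s') :
    ∃ f : ℕ → σ, f 0 = s₀ ∧ ∀ n, I n (f n) ∧ R n (f n) (f (n + 1)) := by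
  choose g hg using step
  let F : ∀ n, {s // I n s} := fun n =>
    Nat.rec ⟨s₀, h₀⟩ (fun n s => ⟨g n s.1 s.2, (hg n s.1 s.2).1⟩) n
  exact ⟨fun n => (F n).1, rfl, fun n => ⟨(F n).2, (hg n _ (F n).2).2⟩⟩

/-! ### The parametrized pigeonhole principle -/

section Pigeonhole

open Filter

variable {α : Type*} {L : ℕ → Finset α}

theorem countable_of_cover (hcover : ∀ l : α, ∃ n, l ∈ L n) : Countable α := by
  rw [← Set.countable_univ_iff]
  refine Set.Countable.mono (s₂ := ⋃ n, (L n : Set α)) (fun l _ => ?_)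
    (Set.countable_iUnion fun n => (L n).countable_toSet)
  exact Set.mem_iUnion.2 (hcover l)

/-- The state of the construction of a block sequence together with a Cantor scheme: the last
variable word and its support, a strict upper bound for the supports so far, the set of words
generated so far and the sets of the scheme. -/
structure PigeonholeState (α : Type*) where
  word : List (Option α)
  supp : Finset ℕ
  bound : ℕ
  gen : Set (List α)
  part : List Bool → Set (ℕ → Bool)

/-- Here `K n` collects the words with support in `[d, d + n)`. The new index `d + n` is absent, is
the whole support, or comes last after an older word. -/
theorem cat_mem_of_generate {X : VarWordSeq α} {d : ℕ} {K : ℕ → Set (List α)}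
    (hK : ∀ n, K n ⊆ K (n + 1))
    (h : ∀ n, ∀ l ∈ L (d + n), eval (X.1 (d + n)) l ∈ K (n + 1) ∧
      ∀ w ∈ K n, w ++ eval (X.1 (d + n)) l ∈ K (n + 1)) (l : ℕ → α) (n : ℕ) :
    ∀ s : Finset ℕ, s.Nonempty → (∀ j ∈ s, d ≤ j ∧ j < d + n) → (∀ j ∈ s, l j ∈ L j) →
      cat (fun n => eval (X.1 n) (l n)) s ∈ K n := by
  induction n with
  | zero =>
    rintro s ⟨j, hj⟩ hs
    have := hs j hj
    omega
  | succ n ih =>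
    intro s hne hs hl
    have hlt : ∀ i ∈ s.erase (d + n), i < d + n := fun i hi => by
      have := hs i (Finset.mem_of_mem_erase hi)
      have := Finset.ne_of_mem_erase hi
      omega
    by_cases hn : d + n ∈ s
    · have hln := h n _ (hl _ hn)
      rw [← Finset.insert_erase hn, cat_insert _ hlt]
      rcases (s.erase (d + n)).eq_empty_or_nonempty with h0 | h0
      · rw [h0, cat_empty]
        exact hln.1
      · exact hln.2 _ (ih _ h0 (fun j hj => ⟨(hs j (Finset.mem_of_mem_erase hj)).1, hlt j hj⟩)
          fun j hj => hl j (Finset.mem_of_mem_erase hj))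
    · rw [Finset.erase_eq_of_notMem hn] at hlt
      exact hK n (ih s hne (fun j hj => ⟨(hs j hj).1, hlt j hj⟩) hl)

/-- The parametrized pigeonhole principle. -/
theorem exists_monochromatic (hmono : Monotone L) (hcover : ∀ l : α, ∃ n, l ∈ L n) (l₀ : α)
    (X : VarWordSeq α) (d : ℕ) {κ : Type*} [Finite κ] {M : Set (ℕ → Bool)}
    (hM : M ∈ perfectSets) (C : κ → List α → Set (ℕ → Bool)) (hC : ∀ i w, IsClosed (C i w))
    (hMC : ∀ w, TailWord L X d w → M ⊆ ⋃ i, C i w) :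
    ∃ i, ∃ M' ∈ perfectSets, M' ⊆ M ∧ ∃ X' ∈ basicVar L d X,
      ∀ w, TailWord L X' d w → M' ⊆ C i w := by
  have := countable_of_cover hcover
  obtain ⟨u, v, huu, huX, hvX, huv⟩ := exists_ultrafilter hmono hcover l₀ X
  -- Each `x ∈ M` has a colour along `u`, and finitely many colours cannot all have countable
  -- classes. The chosen class need not be closed, so the scheme uses uncountable sets and takes
  -- closures only at the end.
  obtain ⟨i, hi⟩ : ∃ i, ¬ {x ∈ M | ∀ᶠ w in u, x ∈ C i w}.Countable := by
    by_contra hcon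
    push Not at hcon
    refine not_countable_of_mem_perfectSets hM ((Set.countable_iUnion hcon).mono fun x hx => ?_)
    have : ∀ᶠ w in u, ∃ i, x ∈ C i w := by
      filter_upwards [huX d] with w hw
      exact Set.mem_iUnion.1 (hMC w hw hx)
    obtain ⟨i, hi⟩ := Ultrafilter.eventually_exists_iff.1 this
    exact Set.mem_iUnion.2 ⟨i, hx, hi⟩
  set D₀ := {x ∈ M | ∀ᶠ w in u, x ∈ C i w} with hD₀
  -- Idempotence of `u` makes `G` self-reproducing: almost every extension of a word satisfying `G
  -- x` satisfies it again.
  let G : (ℕ → Bool) → List α → Prop := fun x w => x ∈ C i w ∧ ∀ᶠ y in u, x ∈ C i (w ++ y)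
  have hG1 : ∀ x ∈ D₀, ∀ᶠ w in u, G x w := fun x hx => hx.2.and ((huu _).1 hx.2)
  have hG2 : ∀ x w, G x w → ∀ᶠ y in u, G x (w ++ y) := fun x w h => by
    have h2 := (huu fun y => x ∈ C i (w ++ y)).1 h.2
    simp only [← List.append_assoc] at h2
    exact h.2.and h2
  let I : ℕ → PigeonholeState α → Prop := fun n s => s.gen.Finite ∧
    ∀ l, l.length = n → ¬ (s.part l).Countable ∧ s.part l ⊆ D₀ ∧
      ∀ w ∈ s.gen, ∀ x ∈ s.part l, G x w
  let R : ℕ → PigeonholeState α → PigeonholeState α → Prop := fun n s s' =>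
    (IsSuppVar L X s'.word s'.supp ∧ ∀ j ∈ s'.supp, d ≤ j ∧ s.bound ≤ j ∧ j < s'.bound) ∧
    (s.gen ⊆ s'.gen ∧ ∀ a ∈ L (d + n), eval s'.word a ∈ s'.gen ∧
      ∀ w ∈ s.gen, w ++ eval s'.word a ∈ s'.gen) ∧
    ∀ l, l.length = n → (∀ b, s'.part (b :: l) ⊆ s.part l) ∧
      Disjoint (closure (s'.part (false :: l))) (closure (s'.part (true :: l))) ∧
      ∀ b, ∀ x ∈ closure (s'.part (b :: l)), ∀ y ∈ closure (s'.part (b :: l)),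
        ∀ i < n, x i = y i
  have step : ∀ n s, I n s → ∃ s', I (n + 1) s' ∧ R n s s' := by
    rintro n s ⟨hfin, hs⟩
    let good : List (Option α) → (ℕ → Bool) → Prop := fun z x =>
      ∀ a ∈ L (d + n), G x (eval z a) ∧ ∀ w ∈ s.gen, G x (w ++ eval z a)
    have hgood : ∀ l, l.length = n → ∀ x ∈ s.part l, ∀ᶠ z in v, good z x := by
      intro l hl x hx
      obtain ⟨-, h1, h2⟩ := hs l hl
      refine (Filter.eventually_all_finset _).2 fun a ha => Filter.Eventually.and ?_
        ((Filter.eventually_all_finite hfin).2 fun w hw => ?_)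
      · exact (huv a _).1 (hG1 x (h1 hx))
      · exact (huv a fun y => G x (w ++ y)).1 (hG2 x w (h2 w hw x hx))
    -- The suitable `z` depend on `x`, but there are only countably many words. If `v`-almost every
    -- `z` served only countably many `x`, these countable sets would cover the uncountable part.
    have hbig : ∀ l, l.length = n → ∀ᶠ z in v, ¬ {x ∈ s.part l | good z x}.Countable := by
      intro l hl
      by_contra hcon
      rw [← Ultrafilter.eventually_not] at hcon
      simp only [not_not] at hcon
      refine (hs l hl).1 (Set.Countable.mono (s₂ := ⋃ z ∈ {z | {x ∈ s.part l | good z x}.Countable},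
        {x ∈ s.part l | good z x}) (fun x hx => ?_)
        (Set.Countable.biUnion (Set.to_countable _) fun z hz => hz))
      obtain ⟨z, hz1, hz2⟩ := (hcon.and (hgood l hl x hx)).exists
      exact Set.mem_biUnion (x := z) hz1 ⟨hx, hz2⟩
    obtain ⟨z, hz, t, ht, htd⟩ := (((Filter.eventually_all_finite
      (List.finite_length_eq Bool n)).2 hbig).and (hvX (max d s.bound))).exists
    choose! U hUcl hUunc hUdisj hUsmall using fun l (hl : l.length = n) => 
      exists_split (hz l (by exact hl)) n
    let part : List Bool → Set (ℕ → Bool) := fun l =>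
      {x ∈ s.part l.tail | good z x} ∩ U l.tail (l.headD false)
    have hcl : ∀ b l, l.length = n → closure (part (b :: l)) ⊆ U l b := fun b l hl =>
      closure_minimal Set.inter_subset_right (hUcl l hl b)
    refine ⟨⟨z, t, t.sup id + 1, s.gen ∪ ((fun a => eval z a) '' (L (d + n)) ∪
      Set.image2 (fun w a => w ++ eval z a) s.gen (L (d + n))), part⟩, ⟨?_, ?_⟩,
      ⟨ht, fun j hj => ?_⟩, ⟨Set.subset_union_left, fun a ha => ⟨?_, fun w hw => ?_⟩⟩,
      fun l hl => ⟨fun b x hx => hx.1.1, ?_, fun b x hx y hy => ?_⟩⟩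
    · exact hfin.union (((L (d + n)).finite_toSet.image _).union
        (hfin.image2 _ (L (d + n)).finite_toSet))
    · intro l hl
      obtain ⟨b, l, rfl⟩ := List.exists_cons_of_length_eq_add_one hl
      have hl' : l.length = n := by simpa using hl
      refine ⟨hUunc l hl' b, fun x hx => (hs l hl').2.1 hx.1.1, ?_⟩
      rintro w (hw | ⟨a, ha, rfl⟩ | ⟨w, hw, a, ha, rfl⟩) x hx
      · exact (hs l hl').2.2 w hw x hx.1.1
      · exact (hx.1.2 a ha).1
      · exact (hx.1.2 a ha).2 w hw
    · have h1 := htd j hj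
      have h2 := Finset.le_sup (f := id) hj
      simp only [id] at h2
      exact ⟨by omega, by omega, by simp only; omega⟩
    · exact .inr (.inl ⟨a, ha, rfl⟩)
    · exact .inr (.inr ⟨w, hw, a, ha, rfl⟩)
    · exact (hUdisj l hl).mono (hcl _ l hl) (hcl _ l hl)
    · exact hUsmall l hl b x (hcl b l hl hx) y (hcl b l hl hy)
  obtain ⟨f, hf0, hf⟩ := exists_seq_of_step I R (s₀ := ⟨[], ∅, 0, ∅, fun _ => D₀⟩)
    ⟨Set.finite_empty, fun l _ => ⟨hi, subset_rfl, fun w hw => hw.elim⟩⟩ step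
  have hbound : Monotone fun n => (f n).bound := by
    refine monotone_nat_of_le_succ fun n => ?_
    obtain ⟨⟨j, hj⟩, -⟩ := (hf n).2.1.1
    have := (hf n).2.1.2 j hj
    omega
  obtain ⟨X', hX', hXz⟩ := exists_mem_basicVar d (z := fun n => (f (n + 1)).word)
    (fun n => (hf n).2.1.1) (fun n j hj => ((hf n).2.1.2 j hj).1) (fun n m hnm j hj k hk => by
      have h1 := ((hf n).2.1.2 j hj).2.2
      have h2 := ((hf m).2.1.2 k hk).2.1
      have h3 := hbound (show n + 1 ≤ m from hnm)
      simp only at h3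
      omega)
  let A : List Bool → Set (ℕ → Bool) := fun l => closure ((f l.length).part l)
  have hAsub : ∀ b l, A (b :: l) ⊆ A l := fun b l =>
    closure_mono (((hf l.length).2.2.2 l rfl).1 b)
  refine ⟨i, schemeLimit A, schemeLimit_mem_perfectSets (fun _ => isClosed_closure) (fun l => ?_)
    hAsub (fun l => ((hf l.length).2.2.2 l rfl).2.1) (fun b l => ((hf l.length).2.2.2 l rfl).2.2 b),
    ?_, X', hX', ?_⟩
  · refine Set.Nonempty.closure (Set.nonempty_iff_ne_empty.2 fun h => ?_)
    exact ((hf l.length).1.2 l rfl).1 (h ▸ Set.countable_empty)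
  · refine (schemeLimit_subset A 0).trans (Set.iUnion₂_subset fun l hl => ?_)
    have hl : l.length = 0 := hl
    refine closure_minimal ?_ hM.1.closed
    exact (((hf l.length).1.2 l rfl).2.1).trans fun x hx => hx.1
  · rintro w ⟨s, ⟨hne, p, hp, rfl⟩, hd⟩
    have hgen : ∀ n, ∀ a ∈ L (d + n), eval (X'.1 (d + n)) a ∈ (f (n + 1)).gen ∧
        ∀ w ∈ (f n).gen, w ++ eval (X'.1 (d + n)) a ∈ (f (n + 1)).gen := fun n => by
      rw [hXz]
      exact (hf n).2.2.1.2
    have hw := cat_mem_of_generate (K := fun n => (f n).gen) (fun n => (hf n).2.2.1.1) hgen p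
      (s.sup id + 1) s hne (fun j hj => ⟨hd j hj, by
        have := Finset.le_sup (f := id) hj
        simp only [id] at this
        omega⟩) hp
    refine (schemeLimit_subset A (s.sup id + 1)).trans (Set.iUnion₂_subset fun l hl => ?_)
    -- Since `C i w` is closed, the colour passes from the parts to their closures.
    refine closure_minimal (fun x hx => ?_) (hC i _)
    have hl : l.length = s.sup id + 1 := hl
    rw [← hl] at hw
    exact (((hf l.length).1.2 l rfl).2.2 _ hw x hx).1

end Pigeonhole

/-! ### Fusion of sequences and perfect sets -/

section Fusion

variable {α : Type*} {L : ℕ → Finset α}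

/-- The term `i` no longer changes from `Xs (i + 1)` on. Each finite part of the limit has block
supports in `Xs k` inherited from a later `Xs j`, and uniqueness of supports makes these choices
agree. -/
theorem exists_limit (hmono : Monotone L) (d : ℕ) {Xs : ℕ → VarWordSeq α}
    (h : ∀ k, Xs (k + 1) ∈ basicVar L (d + k) (Xs k)) :
    ∃ X : VarWordSeq α, ∀ k, X ∈ basicVar L (d + k) (Xs k) := by
  have hle : ∀ k j, k ≤ j → Xs j ∈ basicVar L (d + k) (Xs k) := by
    intro k j hkj
    induction j, hkj using Nat.le_induction with
    | base => exact basicVar_refl _ _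
    | succ j hkj ih => exact basicVar_trans hmono (basicVar_anti (by omega) (h j)) ih
  have heq : ∀ k, ∀ i < d + k, (Xs (i + 1)).1 i = (Xs k).1 i := by
    intro k i hi
    rcases le_total k (i + 1) with hk | hk
    · exact (mem_basicVar.1 (hle _ _ hk)).2 i hi
    · exact ((mem_basicVar.1 (hle _ _ hk)).2 i (by omega)).symm
  let x : ℕ → List (Option α) := fun i => (Xs (i + 1)).1 i
  have hx : RapidlyIncreasing x := by
    intro n
    refine (Finset.sum_congr rfl fun i hi => ?_).trans_lt ((Xs (n + 1)).2.2 n)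
    have := Finset.mem_range.1 hi
    simp only [x, heq (n + 1) i (by omega)]
  refine ⟨⟨x, fun n => (Xs (n + 1)).2.1 n, hx⟩, fun k => mem_basicVar.2 ⟨?_, heq k⟩⟩
  have key : ∀ j, k ≤ j → ∃ T : ℕ → Finset ℕ, IsBlock T ∧
      ∀ i < d + j, IsSuppVar L (Xs k) (x i) (T i) := by
    intro j hkj
    obtain ⟨T, hT, hTb⟩ := (hle k j hkj).1
    exact ⟨T, hTb, fun i hi => by rw [show x i = (Xs j).1 i from heq j i hi]; exact hT i⟩
  have hS : ∀ i, ∃ S, IsSuppVar L (Xs k) (x i) S := fun i => by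
    obtain ⟨T, -, hT⟩ := key (max k (i + 1)) (le_max_left _ _)
    exact ⟨_, hT i (by omega)⟩
  choose S hS using hS
  refine ⟨S, hS, fun n m hnm => ?_⟩
  obtain ⟨T, hTb, hT⟩ := key (max k (m + 1)) (le_max_left _ _)
  rw [(hS n).unique (hT n (by omega)), (hS m).unique (hT m (by omega))]
  exact hTb n m hnm

variable {Φ : Set (ℕ → Bool) → List (List α) → VarWordSeq α → Prop}

/-- The pairs are treated one at a time. The common depth `N` keeps the first `N` terms, and with
them all depths, unchanged, and heredity preserves what was already achieved. -/
theorem exists_forall_finset (hmono : Monotone L)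
    (hΦ : ∀ M M' b X X', M' ⊆ M → basic L b X' ⊆ basic L b X → (basic L b X').Nonempty →
      Φ M b X → Φ M' b X')
    (hd : ∀ M ∈ perfectSets, ∀ b X, (basic L b X).Nonempty → ∃ M' ∈ perfectSets, M' ⊆ M ∧
      ∃ X' ∈ basicVar L (depth L X b) X, Φ M' b X')
    {F : List Bool → Set (ℕ → Bool)} (hF : ∀ l, F l ∈ perfectSets) {X : VarWordSeq α} {N : ℕ}
    (T : Finset (List Bool × List (List α)))
    (hT : ∀ t ∈ T, (basic L t.2 X).Nonempty ∧ depth L X t.2 = N) :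
    ∃ F' : List Bool → Set (ℕ → Bool), (∀ l, F' l ∈ perfectSets ∧ F' l ⊆ F l) ∧
      ∃ X' ∈ basicVar L N X, ∀ t ∈ T, Φ (F' t.1) t.2 X' := by
  classical
  induction T using Finset.induction_on with
  | empty => exact ⟨F, fun l => ⟨hF l, subset_rfl⟩, X, basicVar_refl _ _, by simp⟩
  | insert t T _ ih =>
    obtain ⟨F', hF', X', hX', h⟩ := ih fun t ht => hT t (by simp [ht])
    have hN : ∀ t' ∈ insert t T, (basic L t'.2 X').Nonempty ∧ depth L X' t'.2 = N := by
      intro t' ht'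
      obtain ⟨h1, h2⟩ := hT t' ht'
      obtain ⟨h3, h4⟩ := basic_nonempty_of_mem hmono h1 (by rwa [h2])
      exact ⟨h3, h4.trans h2⟩
    obtain ⟨ht1, ht2⟩ := hN t (by simp)
    obtain ⟨M, hM, hMF, X'', hX'', hΦM⟩ := hd (F' t.1) (hF' t.1).1 t.2 X' ht1
    rw [ht2] at hX''
    refine ⟨Function.update F' t.1 M, fun l => ?_, X'', basicVar_trans hmono hX'' hX', ?_⟩
    · by_cases hl : l = t.1
      · subst hl
        rw [Function.update_self]
        exact ⟨hM, hMF.trans (hF' _).2⟩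
      · rw [Function.update_of_ne hl]
        exact hF' l
    · intro t' ht'
      rcases Finset.mem_insert.1 ht' with rfl | ht
      · rwa [Function.update_self]
      · obtain ⟨h1, h2⟩ := hN t' ht'
        refine hΦ (F' t'.1) _ _ X' _ ?_ (basic_subset_of_mem hmono hX'' _)
          (basic_nonempty_of_mem hmono h1 (by rwa [h2])).1 (h t' ht)
        by_cases hl : t'.1 = t.1
        · rw [hl, Function.update_self]
          exact hMF
        · rw [Function.update_of_ne hl]

/-- Fusion: a hereditary and dense property of triples `(M, b, X)` holds, after shrinking `M` and
`X`, for all `b` extending `a`, locally in `M`. -/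
theorem exists_fusion (hmono : Monotone L)
    (hΦ : ∀ M M' b X X', M' ⊆ M → basic L b X' ⊆ basic L b X → (basic L b X').Nonempty →
      Φ M b X → Φ M' b X')
    (hd : ∀ M ∈ perfectSets, ∀ b X, (basic L b X).Nonempty → ∃ M' ∈ perfectSets, M' ⊆ M ∧
      ∃ X' ∈ basicVar L (depth L X b) X, Φ M' b X')
    {Q : Set (ℕ → Bool)} (hQ : Q ∈ perfectSets) {a : List (List α)} {Y : VarWordSeq α}
    (hY : (basic L a Y).Nonempty) :
    ∃ M ∈ perfectSets, M ⊆ Q ∧ ∃ X ∈ basicVar L (depth L Y a) Y,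
      ∀ b, a <+: b → (basic L b X).Nonempty →
        ∃ F : Set (Set (ℕ → Bool)), F.Finite ∧ (∀ N ∈ F, N ∈ perfectSets ∧ Φ N b X) ∧
          M ⊆ ⋃₀ F := by
  set d := depth L Y a with hd'
  let R : ℕ → (List Bool → Set (ℕ → Bool)) × VarWordSeq α →
      (List Bool → Set (ℕ → Bool)) × VarWordSeq α → Prop := fun n s s' =>
    s'.2 ∈ basicVar L (d + n) s.2 ∧
    (∀ l, l.length = n → (∀ b, s'.1 (b :: l) ⊆ s.1 l) ∧
      Disjoint (s'.1 (false :: l)) (s'.1 (true :: l)) ∧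
      ∀ b, ∀ x ∈ s'.1 (b :: l), ∀ y ∈ s'.1 (b :: l), ∀ i < n, x i = y i) ∧
    ∀ l, l.length = n + 1 → ∀ b, (basic L b s.2).Nonempty → depth L s.2 b = d + n →
      Φ (s'.1 l) b s'.2
  obtain ⟨f, hf0, hf⟩ := exists_seq_of_step (fun _ s => ∀ l, s.1 l ∈ perfectSets) R
    (s₀ := (fun _ => Q, Y)) (fun _ => hQ) (by
      rintro n ⟨F, X⟩ hF
      choose U hUcl hUunc hUdisj hUsmall using fun l =>
        exists_split (not_countable_of_mem_perfectSets (hF l)) n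
      choose P hP hPF using fun l b =>
        exists_perfect_subset ((hF l).1.closed.inter (hUcl l b)) (hUunc l b)
      -- Stage `n` treats exactly the `b` of depth `d + n`, of which there are finitely many because
      -- each `L k` is finite.
      have hfin := (List.finite_length_eq Bool (n + 1)).prod ((finite_setOf_finLE₀ (L := L) (X := X)
        (d + n)).subset (t := {b | (basic L b X).Nonempty ∧ depth L X b = d + n})
        fun b hb => hb.2 ▸ finLE₀_depth hb.1)
      obtain ⟨F', hF', X', hX', hΦ'⟩ := exists_forall_finset hmono hΦ hd
        (F := fun l => P l.tail (l.headD false)) (fun l => hP _ _) hfin.toFinset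
        fun t ht => ((Set.Finite.mem_toFinset _).1 ht).2
      have hsub : ∀ b l, F' (b :: l) ⊆ F l ∩ U l b := fun b l => (hF' _).2.trans (hPF l b)
      refine ⟨(F', X'), fun l => (hF' l).1, hX', fun l _ => ⟨fun b =>
        (hsub b l).trans Set.inter_subset_left, ?_, fun b x hx y hy => ?_⟩, ?_⟩
      · exact (hUdisj l).mono ((hsub _ l).trans Set.inter_subset_right)
          ((hsub _ l).trans Set.inter_subset_right)
      · exact hUsmall l b x (hsub b l hx).2 y (hsub b l hy).2
      · intro l hl b hb hbd
        exact hΦ' (l, b) ((Set.Finite.mem_toFinset _).2 ⟨hl, hb, hbd⟩))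
  obtain ⟨X, hX⟩ := exists_limit hmono d fun n => (hf n).2.1
  have hX0 : X ∈ basicVar L d Y := by simpa [hf0] using hX 0
  let A : List Bool → Set (ℕ → Bool) := fun l => (f l.length).1 l
  refine ⟨schemeLimit A, schemeLimit_mem_perfectSets (fun l => ((hf _).1 l).1.closed)
    (fun l => ((hf _).1 l).2) (fun b l => ((hf l.length).2.2.1 l rfl).1 b)
    (fun l => ((hf l.length).2.2.1 l rfl).2.1) (fun b l => ((hf l.length).2.2.1 l rfl).2.2 b),
    ?_, X, hX0, fun b hab hb => ?_⟩
  · refine (schemeLimit_subset A 0).trans (Set.iUnion₂_subset fun l hl => ?_)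
    rw [Set.mem_ofPred_eq, List.length_eq_zero_iff] at hl
    subst hl
    simp [A, hf0]
  · have hdb : d ≤ depth L X b := by
      rw [hd', ← (basic_nonempty_of_mem hmono hY hX0).2]
      exact depth_mono hab hb
    obtain ⟨n, hn⟩ := Nat.exists_eq_add_of_le hdb
    have hXn := hX n
    -- A sequence `b` of depth `d + n` was handled at stage `n` on the nodes of level `n + 1`. The
    -- limit `X` agrees with that stage's sequence below `d + n`, so the depth of `b` there is the
    -- same.
    refine ⟨A '' {l | l.length = n + 1}, (List.finite_length_eq Bool (n + 1)).image A, ?_, ?_⟩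
    · rintro _ ⟨l, hl, rfl⟩
      have hl : l.length = n + 1 := hl
      refine ⟨(hf _).1 l, ?_⟩
      have h1 : depth L (f n).2 b = d + n := by
        rw [← hn]
        refine depth_congr (finLE₀_depth hb) fun i hi => (mem_basicVar.1 hXn).2 i ?_
        rwa [← hn]
      have h2 := (hf n).2.2.2 l hl b (hb.mono (basic_subset_of_mem hmono hXn b)) h1
      simp only [A, hl]
      exact hΦ _ _ _ _ _ subset_rfl (basic_subset_of_mem hmono (hX (n + 1)) b) hb h2
    · rw [Set.sUnion_image]
      exact schemeLimit_subset A (n + 1)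

end Fusion

/-! ### Combinatorial forcing and the two equivalences -/

section Forcing

variable {α : Type*} {L : ℕ → Finset α} {Λ : Set ((ℕ → Bool) × WordSeq α)}

/-- `M × [b, X]` is contained in `Λ` or disjoint from it. -/
def Decides (L : ℕ → Finset α) (Λ : Set ((ℕ → Bool) × WordSeq α)) (M : Set (ℕ → Bool))
    (b : List (List α)) (X : VarWordSeq α) : Prop :=
  M ×ˢ basic L b X ⊆ Λ ∨ M ×ˢ basic L b X ⊆ Λᶜ

/-- No product of a perfect subset of `M` with a basic subset of `[b, X]` belonging to `b` decides
`Λ`. -/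
def Rejects (L : ℕ → Finset α) (Λ : Set ((ℕ → Bool) × WordSeq α)) (M : Set (ℕ → Bool))
    (b : List (List α)) (X : VarWordSeq α) : Prop :=
  ∀ N ∈ perfectSets, N ⊆ M → ∀ Z : VarWordSeq α, (basic L b Z).Nonempty →
    basic L b Z ⊆ basic L b X → ¬ Decides L Λ N b Z

theorem Decides.mono {M M' : Set (ℕ → Bool)} {b : List (List α)} {X X' : VarWordSeq α}
    (h : Decides L Λ M b X) (hM : M' ⊆ M) (hX : basic L b X' ⊆ basic L b X) :
    Decides L Λ M' b X' :=
  h.imp (Set.prod_mono hM hX).trans (Set.prod_mono hM hX).trans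

theorem Rejects.mono {M M' : Set (ℕ → Bool)} {b : List (List α)} {X X' : VarWordSeq α}
    (h : Rejects L Λ M b X) (hM : M' ⊆ M) (hX : basic L b X' ⊆ basic L b X) :
    Rejects L Λ M' b X' :=
  fun N hN hNM Z hZ hZX => h N hN (hNM.trans hM) Z hZ (hZX.trans hX)

theorem exists_decides_of_not_rejects (hmono : Monotone L) (hcover : ∀ l : α, ∃ n, l ∈ L n)
    {M : Set (ℕ → Bool)} {b : List (List α)} {X : VarWordSeq α} (h : ¬ Rejects L Λ M b X) :
    ∃ M' ∈ perfectSets, M' ⊆ M ∧ ∃ X' ∈ basicVar L (depth L X b) X, Decides L Λ M' b X' := by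
  simp only [Rejects, not_forall, not_not] at h
  obtain ⟨N, hN, hNM, Z, hZ, hZX, h⟩ := h
  obtain ⟨Y, hY, hYZ⟩ := exists_mem_basicVar_subset hmono hcover hZ hZX
  exact ⟨N, hN, hNM, Y, hY, h.mono subset_rfl hYZ⟩

theorem rejects_of_cover {M : Set (ℕ → Bool)} {b : List (List α)} {X X' : VarWordSeq α}
    {F : Set (Set (ℕ → Bool))} (hF : F.Finite) (hcl : ∀ N ∈ F, IsClosed N) (hMF : M ⊆ ⋃₀ F)
    (h : ∀ N ∈ F, Rejects L Λ N b X) (hX : basic L b X' ⊆ basic L b X) :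
    Rejects L Λ M b X' := by
  intro N hN hNM Z hZ hZX hdec
  obtain ⟨K, hK, N', hN', hN'N, hN'K⟩ :=
    exists_perfect_subset_of_cover hN hF hcl (hNM.trans hMF)
  exact h K hK N' hN' hN'K Z hZ (hZX.trans hX) (hdec.mono hN'N subset_rfl)

theorem exists_decides_or_rejects (hmono : Monotone L) (hcover : ∀ l : α, ∃ n, l ∈ L n)
    {M : Set (ℕ → Bool)} (hM : M ∈ perfectSets) (b : List (List α)) (X : VarWordSeq α) :
    ∃ M' ∈ perfectSets, M' ⊆ M ∧ ∃ X' ∈ basicVar L (depth L X b) X,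
      (Decides L Λ M' b X' ∨ Rejects L Λ M' b X') := by
  by_cases h : Rejects L Λ M b X
  · exact ⟨M, hM, subset_rfl, X, basicVar_refl _ _, .inr h⟩
  · obtain ⟨M', hM', h1, X', hX', h2⟩ := exists_decides_of_not_rejects hmono hcover h
    exact ⟨M', hM', h1, X', hX', .inl h2⟩

/-- Fusion makes each one-word extension of `b` decided or rejected locally in `M`. The three
outcomes colour pairs of a point and a word, and the pigeonhole principle makes one outcome valid
throughout. -/
theorem exists_decides_or_rejects_succ (hmono : Monotone L) (hcover : ∀ l : α, ∃ n, l ∈ L n)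
    {M : Set (ℕ → Bool)} (hM : M ∈ perfectSets) {b : List (List α)} {X : VarWordSeq α}
    (hX : (basic L b X).Nonempty) :
    ∃ M' ∈ perfectSets, M' ⊆ M ∧ ∃ X' ∈ basicVar L (depth L X b) X,
      (Decides L Λ M' b X' ∨
        ∀ w, (basic L (b ++ [w]) X').Nonempty → Rejects L Λ M' (b ++ [w]) X') := by
  obtain ⟨M₁, hM₁, hM₁M, X₁, hX₁, h₁⟩ := exists_fusion
    (Φ := fun M b X => Decides L Λ M b X ∨ Rejects L Λ M b X) hmono
    (fun M M' b X X' hM hX _ h => h.imp (·.mono hM hX) (·.mono hM hX))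
    (fun M hM b X _ => exists_decides_or_rejects hmono hcover hM b X) hM hX
  obtain ⟨hX₁ne, hd₁⟩ := basic_nonempty_of_mem hmono hX hX₁
  obtain ⟨-, l₀, -⟩ := exists_letter hX
  let ψ : Fin 3 → List α → Set (ℕ → Bool) → Prop := fun i w N =>
    ![N ×ˢ basic L (b ++ [w]) X₁ ⊆ Λ, N ×ˢ basic L (b ++ [w]) X₁ ⊆ Λᶜ,
      Rejects L Λ N (b ++ [w]) X₁] i
  have hF : ∀ w, ∃ F : Set (Set (ℕ → Bool)), F.Finite ∧ (∀ N ∈ F, N ∈ perfectSets) ∧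
      (TailWord L X₁ (depth L X b) w → M₁ ⊆ ⋃₀ F ∧ ∀ N ∈ F, ∃ i, ψ i w N) := by
    intro w
    by_cases hw : TailWord L X₁ (depth L X b) w
    · obtain ⟨F, hF, hFp, hMF⟩ := h₁ (b ++ [w]) (List.prefix_append _ _)
        (basic_nonempty_of_tailWord hmono hX₁ne (by rwa [hd₁]))
      refine ⟨F, hF, fun N hN => (hFp N hN).1, fun _ => ⟨hMF, fun N hN => ?_⟩⟩
      rcases (hFp N hN).2 with (h | h) | h
      · exact ⟨0, h⟩
      · exact ⟨1, h⟩
      · exact ⟨2, h⟩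
    · exact ⟨∅, Set.finite_empty, by simp, fun h => (hw h).elim⟩
  choose F hFfin hFp hF using hF
  -- The colour class `i` of `w` is the union of the pieces of its cover with outcome `i`. It is
  -- closed because the cover is finite, and the classes may overlap.
  obtain ⟨i, M₂, hM₂, hM₂M, X₂, hX₂, h₂⟩ := exists_monochromatic hmono hcover l₀ X₁
    (depth L X b) hM₁ (fun i w => ⋃₀ {N ∈ F w | ψ i w N})
    (fun i w => by
      rw [Set.sUnion_eq_biUnion]
      exact ((hFfin w).subset fun N hN => hN.1).isClosed_biUnion
        fun N hN => (hFp w N hN.1).1.closed)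
    (fun w hw x hx => by
      obtain ⟨N, hN, hxN⟩ := (hF w hw).1 hx
      obtain ⟨i, hi⟩ := (hF w hw).2 N hN
      exact Set.mem_iUnion.2 ⟨i, N, ⟨hN, hi⟩, hxN⟩)
  have hX₂' : X₂ ∈ basicVar L (depth L X₁ b) X₁ := by rwa [hd₁]
  have hd₂ := (basic_nonempty_of_mem hmono hX₁ne hX₂').2.trans hd₁
  have hsub := basic_subset_of_mem hmono hX₂
  refine ⟨M₂, hM₂, hM₂M.trans hM₁M, X₂, basicVar_trans hmono hX₂ hX₁, ?_⟩
  -- Every `A ∈ [b, X₂]` lies in `[b ++ [w], X₁]` for its next word `w`, so a common positive or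
  -- negative outcome for all `w` decides `b`.
  have hacc : ∀ Γ : Set ((ℕ → Bool) × WordSeq α),
      (∀ w, TailWord L X₂ (depth L X b) w →
        M₂ ⊆ ⋃₀ {N ∈ F w | N ×ˢ basic L (b ++ [w]) X₁ ⊆ Γ}) → M₂ ×ˢ basic L b X₂ ⊆ Γ := by
    rintro Γ hΓ ⟨x, A⟩ ⟨hx, hA⟩
    obtain ⟨hw, hAw⟩ := tailWord_of_mem_basic hA
    rw [hd₂] at hw
    obtain ⟨N, ⟨-, hN⟩, hxN⟩ := hΓ _ hw hx
    exact hN ⟨hxN, hsub _ hAw⟩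
  fin_cases i
  · exact .inl (.inl (hacc Λ h₂))
  · exact .inl (.inr (hacc Λᶜ h₂))
  · refine .inr fun w hw => ?_
    have hw' := tailWord_of_basic_nonempty hw
    rw [hd₂] at hw'
    exact rejects_of_cover ((hFfin w).subset fun N hN => hN.1)
      (fun N hN => (hFp w N hN.1).1.closed) (h₂ w hw') (fun N hN => hN.2) (hsub _)

theorem PerfectlyBaire.perfectlyRamsey (hmono : Monotone L) (hcover : ∀ l : α, ∃ n, l ∈ L n)
    (hΛ : PerfectlyBaire L Λ) : PerfectlyRamsey L Λ := by
  intro Q hQ a Y hY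
  obtain ⟨M, hM, hMQ, X, hX, h⟩ := exists_fusion
    (Φ := fun M b X => Decides L Λ M b X ∨
      ∀ w, (basic L (b ++ [w]) X).Nonempty → Rejects L Λ M (b ++ [w]) X) hmono
    (fun M M' b X X' hM hX _ h => h.imp (·.mono hM hX) fun h w hw => by
      have hsub : basic L (b ++ [w]) X' ⊆ basic L (b ++ [w]) X := fun A hA =>
        ⟨(hX (basic_anti (List.prefix_append _ _) hA)).1, hA.2⟩
      exact (h w (hw.mono hsub)).mono hM hsub)
    (fun M hM b X hX => exists_decides_or_rejects_succ hmono hcover hM hX) hQ hY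
  obtain ⟨hXne, hd⟩ := basic_nonempty_of_mem hmono hY hX
  by_cases hrej : Rejects L Λ M a X
  swap
  · obtain ⟨M', hM', hM'M, X', hX', hdec⟩ := exists_decides_of_not_rejects hmono hcover hrej
    have hne := (basic_nonempty_of_mem hmono hXne hX').1
    rw [hd] at hX'
    exact ⟨M', hM', hM'M.trans hMQ, X', basicVar_trans hmono hX' hX, hne, hdec⟩
  exfalso
  -- Rejection propagates: on any piece, a decision of `a ++ c` would contradict its rejection, so
  -- the other alternative of the fused property holds there.
  have hall : ∀ c : List (List α), (basic L (a ++ c) X).Nonempty → Rejects L Λ M (a ++ c) X := by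
    intro c
    induction c using List.reverseRecOn with
    | nil => simpa using fun _ => hrej
    | append_singleton c w ih =>
      intro hne
      rw [← List.append_assoc] at hne ⊢
      have hne' := hne.mono (basic_anti (List.prefix_append (a ++ c) [w]))
      obtain ⟨F, hF, hFp, hMF⟩ := h (a ++ c) (List.prefix_append _ _) hne'
      intro N hN hNM Z hZ hZX hdec
      obtain ⟨K, hK, N', hN', hN'N, hN'K⟩ := exists_perfect_subset_of_cover hN hF
        (fun N hN => (hFp N hN).1.1.closed) (hNM.trans hMF)
      rcases (hFp K hK).2 with hK' | hK'
      · exact ih hne' N' hN' (hN'N.trans hNM) X hne' subset_rfl (hK'.mono hN'K subset_rfl)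
      · exact hK' w hne N' hN' hN'K Z hZ hZX (hdec.mono hN'N subset_rfl)
  obtain ⟨N, hN, hNM, b, Z, ⟨A, hA⟩, hZX, hdec⟩ := hΛ M hM a X hXne
  have hAX := hZX hA
  -- The sequence `b` from the Baire property may be shorter than `a`. A common extension `a ++ c`
  -- is read off from a member `A` of `[b, Z]`, and `[a ++ c, Z] ⊆ [b, Z]` inherits the decision.
  have hb := (mem_basic.1 hA).2
  have ha := (mem_basic.1 hAX).2
  set n := max a.length b.length
  have hbn : b <+: initSeg A.1 n := hb ▸ initSeg_prefix A.1 (le_max_right _ _)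
  obtain ⟨c, hc⟩ : a <+: initSeg A.1 n := ha ▸ initSeg_prefix A.1 (le_max_left _ _)
  have hAZ : A ∈ basic L (a ++ c) Z := ⟨hA.1, n, hc.symm⟩
  have hsub : basic L (a ++ c) Z ⊆ basic L b Z := basic_anti (hc ▸ hbn)
  have hZX' : basic L (a ++ c) Z ⊆ basic L (a ++ c) X := fun B hB =>
    ⟨(hZX (hsub hB)).1, hB.2⟩
  exact hall c ⟨A, hZX' hAZ⟩ N hN hNM Z ⟨A, hAZ⟩ hZX'
    (hdec.imp (Set.prod_mono subset_rfl hsub).trans (Set.prod_mono subset_rfl hsub).trans)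

theorem PerfectlyRamsey.perfectlyBaire (hmono : Monotone L) (hΛ : PerfectlyRamsey L Λ) :
    PerfectlyBaire L Λ := by
  intro Q hQ a Y hY
  obtain ⟨M, hM, hMQ, X, hX, hne, h⟩ := hΛ Q hQ a Y hY
  exact ⟨M, hM, hMQ, a, X, hne, basic_subset_of_mem hmono hX a, h⟩

theorem PerfectlyRamseyNull.perfectlyMeager (hmono : Monotone L) (hΛ : PerfectlyRamseyNull L Λ) :
    PerfectlyMeager L Λ := by
  intro Q hQ a Y hY
  obtain ⟨M, hM, hMQ, X, hX, hne, h⟩ := hΛ Q hQ a Y hY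
  exact ⟨M, hM, hMQ, a, X, hne, basic_subset_of_mem hmono hX a, h⟩

theorem PerfectlyMeager.perfectlyBaire (hΛ : PerfectlyMeager L Λ) : PerfectlyBaire L Λ := by
  intro Q hQ a Y hY
  obtain ⟨M, hM, hMQ, b, X, hne, hsub, h⟩ := hΛ Q hQ a Y hY
  exact ⟨M, hM, hMQ, b, X, hne, hsub, .inr h⟩

theorem PerfectlyMeager.perfectlyRamseyNull (hmono : Monotone L)
    (hcover : ∀ l : α, ∃ n, l ∈ L n) (hΛ : PerfectlyMeager L Λ) : PerfectlyRamseyNull L Λ := by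
  intro Q hQ a Y hY
  obtain ⟨M, hM, hMQ, X, hX, hne, h⟩ :=
    hΛ.perfectlyBaire.perfectlyRamsey hmono hcover Q hQ a Y hY
  refine ⟨M, hM, hMQ, X, hX, hne, h.resolve_left fun hΛM => ?_⟩
  obtain ⟨N, hN, hNM, b, Z, ⟨A, hA⟩, hZX, hNZ⟩ := hΛ M hM a X hne
  obtain ⟨x, hx⟩ := hN.2
  exact hNZ (show (x, A) ∈ N ×ˢ basic L b Z from ⟨hx, hA⟩) (hΛM ⟨hNM hx, hZX hA⟩)

end Forcing

end HalesJewettSpace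

theorem mainTheorem3 {α : Type*} (L : ℕ → Finset α) (hmono : Monotone L)
    (hcover : ∀ l : α, ∃ n, l ∈ L n)
    (Λ : Set ((ℕ → Bool) × HalesJewettSpace.WordSeq α)) :
    (HalesJewettSpace.PerfectlyRamsey L Λ ↔ HalesJewettSpace.PerfectlyBaire L Λ) ∧
      (HalesJewettSpace.PerfectlyRamseyNull L Λ ↔ HalesJewettSpace.PerfectlyMeager L Λ) :=
  ⟨⟨fun h => h.perfectlyBaire hmono, fun h => h.perfectlyRamsey hmono hcover⟩,
    ⟨fun h => h.perfectlyMeager hmono, fun h => h.perfectlyRamseyNull hmono hcover⟩⟩
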